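/- Let $d\ge 2$, let $A$ and $B$ be $d$-dimensional systems with a fixed orthonormal basis $\{|k\rangle\}_{k=0}^{d-1}$, and let $\hat A,\hat B$ be finite-dimensional systems. A linear map $\mathcal L_{A\hat A\hat B\to B}$ is a *one-way LOCC channel* ($\mathcal L\in\mathrm{1WL}$) if there are a POVM $\{\Lambda^x_{A\hat A}\}_x$ with finitely many outcomes and quantum channels $\mathcal D^x_{\hat B\to B}$ such that $$\mathcal L(\omega_{A\hat A\hat B})=\sum_x\mathcal D^x_{\hat B\to B}\big(\operatorname{Tr}_{A\hat A}[\Lambda^x_{A\hat A}\,\omega_{A\hat A\hat B}]\big).$$ For a state $\rho_{\hat A\hat B}$ let $\widetilde{\mathcal S}^{\mathcal L}(\omega_A)=\mathcal L(\omega_A\otimes\rho_{\hat A\hat B})$, and define $$e_{\mathrm{1WL}}(\rho)=\inf_{\mathcal L\in\mathrm{1WL}}\tfrac12\big\|\operatorname{id}^d_{A\to B}-\widetilde{\mathcal S}^{\mathcal L}\big\|_\diamond,\qquad e^F_{\mathrm{1WL}}(\rho)=\inf_{\mathcal L\in\mathrm{1WL}}\big(1-F(\operatorname{id}^d_{A\to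 B},\widetilde{\mathcal S}^{\mathcal L})\big),$$ where $\|\mathcal N-\mathcal M\|_\diamond=\sup_{\rho_{RA}}\|\mathcal N(\rho_{RA})-\mathcal M(\rho_{RA})\|_1$ and $F(\mathcal N,\mathcal M)=\inf_{\rho_{RA}}\big\|\sqrt{\mathcal N(\rho_{RA})}\sqrt{\mathcal M(\rho_{RA})}\big\|_1^2$, both over all states with a reference system $R$ of arbitrary finite dimension. Let $W^{z,x}=Z(z)X(x)$ with $Z(z)=\sum_k e^{2\pi ikz/d}|k\rangle\langle k|$ and $X(x)=\sum_k|k\oplus_d x\rangle\langle k|$, and let $$\mathcal D_{A\to B}(\sigma)=\frac1{d^2-1}\sum_{(z,x)\ne(0,0)}W^{z,x}\sigma(W^{z,x})^\dagger .$$ For operators $K,L\ge 0$ on $\hat A\hat B$ with $K+L=I$ put $$\mathcal L_{K,L}(\omega_{A\hat A\hat B})=\operatorname{id}^d_{A\to B}\big(\operatorname{Tr}_{\hat A\hat B}[K_{\hat A\hat B}\,\omega_{A\hat A\hat B}]\big)+\mathcal D_{A\to B}\big(\operatorname{Tr}_{\hat A\hat B}[L_{\hat A\hat B}\,\omega_{A\hat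 A\hat B}]\big).$$ Then: (i) for every state $\rho_{\hat A\hat B}$, $$e_{\mathrm{1WL}}(\rho)=e^F_{\mathrm{1WL}}(\rho)=1-\sup\big\{\operatorname{Tr}[K\rho]: K,L\ge0,\ K+L=I,\ \mathcal L_{K,L}\in\mathrm{1WL}\big\};$$ (ii) for all $K,L\ge0$ with $K+L=I$, the map $\mathcal L_{K,L}$ is a one-way LOCC channel if and only if there are a POVM $\{\Lambda^x_{B\hat A}\}_x$ with finitely many outcomes and quantum channels $\{\mathcal D^x_{\hat B\to B}\}_x$ such that $$K_{\hat A\hat B}=\frac1{d^2}\sum_x\operatorname{Tr}_B\big[T_B(\Lambda^x_{B\hat A})\,\Gamma^{\mathcal D^x}_{\hat BB}\big],$$ where $T_B$ is the partial transpose on $B$ in the basis $\{|k\rangle\}_k$ and $\Gamma^{\mathcal D^x}_{\hat BB}=\sum_{i,j}|i\rangle\langle j|_{\hat B}\otimes\mathcal D^x(|i\rangle\langle j|)$, with $\{|i\rangle\}$ a fixed orthonormal basis of $\hat B$, is the Choi operator of $\mathcal D^x$. -/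

import Mathlib

open scoped Kronecker MatrixOrder ComplexOrder

noncomputable section

namespace Teleport

/-- Linear maps from operators on `ℂⁿ` to operators on `ℂᵐ` (finite index types `n`, `m`). -/
abbrev Superop (n m : Type*) := Matrix n n ℂ →ₗ[ℂ] Matrix m m ℂ

/-! ### States, trace norm, fidelity -/

/-- Density operators: positive semidefinite with unit trace. -/
def IsState {n : Type*} [Fintype n] (ρ : Matrix n n ℂ) : Prop :=
  ρ.PosSemidef ∧ ρ.trace = 1

/-- The trace norm `‖X‖₁ = Tr √(X† X)`. -/
def traceNorm {n : Type*} [Fintype n] [DecidableEq n] (X : Matrix n n ℂ) : ℝ :=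
  (CFC.sqrt (X.conjTranspose * X)).trace.re

/-- Uhlmann fidelity `F(ω, τ) = ‖√ω √τ‖₁²`. -/
def fidelity {n : Type*} [Fintype n] [DecidableEq n] (ω τ : Matrix n n ℂ) : ℝ :=
  traceNorm (CFC.sqrt ω * CFC.sqrt τ) ^ 2

/-! ### Partial traces and transpose -/

/-- `Tr_m` on operators on `m ⊗ n`, as a linear map. -/
def ptraceFst (m n : Type*) [Fintype m] : Superop (m × n) n where
  toFun X := Matrix.of fun p q => ∑ i, X (i, p) (i, q)
  map_add' X Y := by ext p q; simp [Finset.sum_add_distrib]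
  map_smul' c X := by ext p q; simp [Finset.mul_sum]

/-- `Tr_n` on operators on `m ⊗ n`, as a linear map. -/
def ptraceSnd (m n : Type*) [Fintype n] : Superop (m × n) m where
  toFun X := Matrix.of fun i j => ∑ p, X (i, p) (j, p)
  map_add' X Y := by ext p q; simp [Finset.sum_add_distrib]
  map_smul' c X := by ext p q; simp [Finset.mul_sum]

/-- `T_m`: the transpose of the first tensor factor of an operator on `m ⊗ n`. -/
def ptransposeFst {m n : Type*} (X : Matrix (m × n) (m × n) ℂ) : Matrix (m × n) (m × n) ℂ :=
  Matrix.of fun u v => X (v.1, u.2) (u.1, v.2)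

/-! ### Channels -/

/-- `id_R ⊗ N` applied to an operator on `R ⊗ n`, where `R` has dimension `k`. -/
def amplify {n m : Type*} (k : ℕ) (N : Superop n m)
    (X : Matrix (Fin k × n) (Fin k × n) ℂ) : Matrix (Fin k × m) (Fin k × m) ℂ :=
  Matrix.of fun u v => N (Matrix.of fun i j => X (u.1, i) (v.1, j)) u.2 v.2

/-- Complete positivity: `id_R ⊗ N` is positive for every finite-dimensional `R`. -/
def IsCP {n m : Type*} (N : Superop n m) : Prop :=
  ∀ (k : ℕ) (X : Matrix (Fin k × n) (Fin k × n) ℂ), X.PosSemidef → (amplify k N X).PosSemidef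

/-- Trace preservation. -/
def IsTP {n m : Type*} [Fintype n] [Fintype m] (N : Superop n m) : Prop :=
  ∀ X : Matrix n n ℂ, (N X).trace = X.trace

/-- Quantum channels: completely positive, trace-preserving maps. -/
def IsChannel {n m : Type*} [Fintype n] [Fintype m] (N : Superop n m) : Prop :=
  IsCP N ∧ IsTP N

/-- The Choi operator `Γ^N = N(∑_{i,j} |i⟩⟨j| ⊗ |i⟩⟨j|) = ∑_{i,j} |i⟩⟨j| ⊗ N(|i⟩⟨j|)`, an operator
on (input) `⊗` (output). -/
def choi {n m : Type*} [DecidableEq n] (N : Superop n m) : Matrix (n × m) (n × m) ℂ :=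
  Matrix.of fun u v => N (Matrix.single u.1 v.1 1) u.2 v.2

/-- The diamond distance `‖N - M‖_⋄`: the supremum of `‖(id_R ⊗ N)(ρ) - (id_R ⊗ M)(ρ)‖₁` over all
states `ρ` of `R ⊗ n`, with `R` of arbitrary finite dimension. -/
def diamondDist {n m : Type*} [Fintype n] [Fintype m] [DecidableEq m] (N M : Superop n m) : ℝ :=
  sSup {t : ℝ | ∃ (k : ℕ) (ρ : Matrix (Fin k × n) (Fin k × n) ℂ),
    IsState ρ ∧ t = traceNorm (amplify k N ρ - amplify k M ρ)}

/-- The channel fidelity: the infimum of `F((id_R ⊗ N)(ρ), (id_R ⊗ M)(ρ))` over all states `ρ` of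
`R ⊗ n`, with `R` of arbitrary finite dimension. -/
def channelFidelity {n m : Type*} [Fintype n] [Fintype m] [DecidableEq m]
    (N M : Superop n m) : ℝ :=
  sInf {t : ℝ | ∃ (k : ℕ) (ρ : Matrix (Fin k × n) (Fin k × n) ℂ),
    IsState ρ ∧ t = fidelity (amplify k N ρ) (amplify k M ρ)}

/-! ### One-way LOCC and simulation of the identity channel

The systems `A` and `B` have index type `Fin d`; the systems `Â` and `B̂` of the resource state have
index types `a` and `b`. Operators on `A ⊗ Â ⊗ B̂` are indexed by `Fin d × (a × b)`. -/

/-- A positive operator-valued measure with finitely many outcomes. -/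
def IsPOVM {ι n : Type*} [Fintype ι] [DecidableEq n] (Λ : ι → Matrix n n ℂ) : Prop :=
  (∀ x, (Λ x).PosSemidef) ∧ ∑ x, Λ x = 1

/-- `Tr_{AÂ}[(Λ_{AÂ} ⊗ I_{B̂}) ω_{AÂB̂}]`, the unnormalized state of `B̂` after Alice's outcome
`Λ`. -/
def aliceOutcome {d : ℕ} {a b : Type*} [Fintype a] [Fintype b] [DecidableEq b]
    (Λ : Matrix (Fin d × a) (Fin d × a) ℂ)
    (ω : Matrix (Fin d × (a × b)) (Fin d × (a × b)) ℂ) : Matrix b b ℂ :=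
  ptraceFst (Fin d × a) b ((Λ ⊗ₖ (1 : Matrix b b ℂ)) *
    ω.submatrix (Equiv.prodAssoc (Fin d) a b) (Equiv.prodAssoc (Fin d) a b))

/-- One-way LOCC maps `AÂB̂ → B`: Alice measures a POVM on `AÂ` and sends the outcome `x` to Bob,
who applies a channel `𝒟 x` from `B̂` to `B`. -/
def IsOneWayLOCC {d : ℕ} {a b : Type*} [Fintype a] [DecidableEq a] [Fintype b] [DecidableEq b]
    (𝓛 : Superop (Fin d × (a × b)) (Fin d)) : Prop :=
  ∃ (r : ℕ) (Λ : Fin r → Matrix (Fin d × a) (Fin d × a) ℂ) (𝒟 : Fin r → Superop b (Fin d)),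
    IsPOVM Λ ∧ (∀ x, IsChannel (𝒟 x)) ∧
      ∀ ω, 𝓛 ω = ∑ x, 𝒟 x (aliceOutcome (Λ x) ω)

/-- The simulation channel `ω_A ↦ 𝓛(ω_A ⊗ ρ_{ÂB̂})`. -/
def simChannel {d : ℕ} {a b : Type*} (𝓛 : Superop (Fin d × (a × b)) (Fin d))
    (ρ : Matrix (a × b) (a × b) ℂ) : Superop (Fin d) (Fin d) where
  toFun ω := 𝓛 (ω ⊗ₖ ρ)
  map_add' X Y := by rw [Matrix.add_kronecker, map_add]
  map_smul' c X := by rw [Matrix.smul_kronecker, map_smul, RingHom.id_apply]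

/-- The simulation error in normalized diamond distance, minimized over one-way LOCC maps. -/
def simError (d : ℕ) {a b : Type*} [Fintype a] [DecidableEq a] [Fintype b] [DecidableEq b]
    (ρ : Matrix (a × b) (a × b) ℂ) : ℝ :=
  sInf {e : ℝ | ∃ 𝓛 : Superop (Fin d × (a × b)) (Fin d), IsOneWayLOCC 𝓛 ∧
    e = 1 / 2 * diamondDist LinearMap.id (simChannel 𝓛 ρ)}

/-- The simulation error in channel infidelity, minimized over one-way LOCC maps. -/
def simErrorF (d : ℕ) {a b : Type*} [Fintype a] [DecidableEq a] [Fintype b] [DecidableEq b]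
    (ρ : Matrix (a × b) (a × b) ℂ) : ℝ :=
  sInf {e : ℝ | ∃ 𝓛 : Superop (Fin d × (a × b)) (Fin d), IsOneWayLOCC 𝓛 ∧
    e = 1 - channelFidelity LinearMap.id (simChannel 𝓛 ρ)}

/-! ### The Heisenberg–Weyl operators and the covariant map defined by `K` and `L` -/

/-- `Z(z) = ∑_k e^{2πikz/d} |k⟩⟨k|`. -/
def hwZ (d : ℕ) (z : Fin d) : Matrix (Fin d) (Fin d) ℂ :=
  Matrix.diagonal fun k =>
    Complex.exp (2 * Real.pi * Complex.I * ((k : ℕ) : ℂ) * ((z : ℕ) : ℂ) / (d : ℂ))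

/-- `X(x) = ∑_k |k ⊕ x⟩⟨k|`, with addition modulo `d`. -/
def hwX (d : ℕ) (x : Fin d) : Matrix (Fin d) (Fin d) ℂ :=
  Matrix.of fun j k => if (j : ℕ) = ((k : ℕ) + (x : ℕ)) % d then 1 else 0

/-- `W^{z,x} = Z(z) X(x)`. -/
def hwW (d : ℕ) (zx : Fin d × Fin d) : Matrix (Fin d) (Fin d) ℂ :=
  hwZ d zx.1 * hwX d zx.2

/-- The randomizing channel `σ ↦ (d² - 1)⁻¹ ∑_{(z,x) ≠ (0,0)} W^{z,x} σ (W^{z,x})†`. -/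
def randomizing (d : ℕ) : Superop (Fin d) (Fin d) where
  toFun σ := (1 / ((d : ℂ) ^ 2 - 1)) •
    ∑ zx : Fin d × Fin d with ¬ ((zx.1 : ℕ) = 0 ∧ (zx.2 : ℕ) = 0),
      hwW d zx * σ * (hwW d zx).conjTranspose
  map_add' X Y := by
    simp only [Matrix.mul_add, Matrix.add_mul, Finset.sum_add_distrib, smul_add]
  map_smul' c X := by
    simp only [Matrix.mul_smul, Matrix.smul_mul, ← Finset.smul_sum, RingHom.id_apply]
    rw [smul_comm]

/-- `ω ↦ Tr_{ÂB̂}[(I_A ⊗ K_{ÂB̂}) ω_{AÂB̂}]`. -/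
def measureOut (d : ℕ) {a b : Type*} [Fintype a] [Fintype b]
    (K : Matrix (a × b) (a × b) ℂ) : Superop (Fin d × (a × b)) (Fin d) where
  toFun ω := ptraceSnd (Fin d) (a × b) (((1 : Matrix (Fin d) (Fin d) ℂ) ⊗ₖ K) * ω)
  map_add' X Y := by rw [Matrix.mul_add, map_add]
  map_smul' c X := by rw [Matrix.mul_smul, map_smul, RingHom.id_apply]

/-- `ω ↦ id(Tr_{ÂB̂}[K ω]) + 𝒟(Tr_{ÂB̂}[L ω])`, with `𝒟` the randomizing channel. -/
def covariantMap (d : ℕ) {a b : Type*} [Fintype a] [Fintype b]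
    (K L : Matrix (a × b) (a × b) ℂ) : Superop (Fin d × (a × b)) (Fin d) :=
  measureOut d K + randomizing d ∘ₗ measureOut d L

/-- `Tr_B[T_B(Λ_{BÂ}) Γ_{B̂B}]` for operators `Λ` on `BÂ` and `Γ` on `B̂B`: both are extended by
identities to `B ⊗ Â ⊗ B̂` and multiplied there; the result is an operator on `ÂB̂`. -/
def linkProduct {d : ℕ} {a b : Type*} [Fintype a] [DecidableEq a] [Fintype b] [DecidableEq b]
    (Λ : Matrix (Fin d × a) (Fin d × a) ℂ) (Γ : Matrix (b × Fin d) (b × Fin d) ℂ) :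
    Matrix (a × b) (a × b) ℂ :=
  ptraceFst (Fin d) (a × b) <|
    (ptransposeFst Λ ⊗ₖ (1 : Matrix b b ℂ)).submatrix
        (Equiv.prodAssoc (Fin d) a b).symm (Equiv.prodAssoc (Fin d) a b).symm *
      ((1 : Matrix a a ℂ) ⊗ₖ Γ).submatrix
        (fun u : Fin d × (a × b) => (u.2.1, (u.2.2, u.1)))
        (fun u : Fin d × (a × b) => (u.2.1, (u.2.2, u.1)))

end Teleport

end

/-!
A one-way LOCC protocol `𝓛` is compared with the identity through its entanglement fidelity: for an
operator `τ` on `ÂB̂`, feed half of the maximally entangled state `Φ` into `σ ↦ 𝓛(σ ⊗ τ)` and take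
the overlap of the output with `Φ`. This is linear in `τ`, hence equal to `Tr[K τ]` for an operator
`K` (`overlapOperator`), and `0 ≤ K ≤ 1` because `𝓛` is a channel.

*Twirling.* One-way LOCC maps are convex and closed under `𝓛 ↦ U 𝓛(U† · U) U†`
(`IsOneWayLOCC.sum_smul`, `IsOneWayLOCC.conjMap`), so any average over finitely many unitaries is
available. Averaging over the Heisenberg–Weyl group would only yield a mixture of Heisenberg–Weyl
conjugations; a unitary 2-design is needed, and an explicit finite one is used. Averaging over
monomial matrices with cube-root phases leaves the maps `α σ + β Tr[σ] 1 + γ Δ(σ)`, with `Δ` the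
projection onto the diagonal (`exists_monomialTwirl_eq`). Conjugating by the discrete Fourier
transform and averaging again replaces `γ` by `-γ / d`, so weights `1 : d` remove it
(`exists_isotropicTwirl_eq`). The surviving map `N` is determined by `Tr N(1)` and its
entanglement fidelity, both unchanged by the twirl, and is therefore the covariant map of `K` and `1 - K`
(`IsOneWayLOCC.covariantMap`); here the randomizing channel enters as
`σ ↦ (d Tr[σ] 1 - σ) / (d² - 1)` (`randomizing_apply`).

*Errors.* With resource state `ρ`, the covariant map of `K` and `L` simulates
`p id + (1 - p) 𝒟` with `p = Tr[K ρ]`. Both of its errors are at most `1 - p`: the trace distance of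
states is at most `2`, and `F(ω, τ) ≥ p` whenever `τ ≥ p ω`, by operator monotonicity of the square
root (`le_fidelity`). Conversely, on the input `Φ` both errors of an arbitrary protocol are at least
`1 - p`, with `p` its entanglement fidelity (`le_traceNorm_pure_sub`, `fidelity_pure_le`), which is
a value `Tr[K ρ]` with covariant map in one-way LOCC by twirling.

*Link products.* The operator `K` of the protocol with POVM `Λ^x` and channels `X ↦ 𝒟^x(Xᵀ)ᵀ` is
`d⁻²` times the sum of the link products of `Λ^x` with the Choi operators of `𝒟^x`
(`entTrace_link`). As `𝒟 ↦ (X ↦ 𝒟(Xᵀ)ᵀ)` is an involution of the channels, these sums are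
exactly the operators `K` of one-way LOCC maps.
-/

noncomputable section

namespace Teleport

/-! ### Trace norm and fidelity -/

section TraceNorm

variable {n : Type*} [Fintype n]

/-- Cauchy–Schwarz for a diagonal entry of a product. -/
lemma re_mul_apply_le (Y Z : Matrix n n ℂ) (i : n) :
    ((Y * Z) i i).re ≤
      √((Y * Y.conjTranspose) i i).re * √((Z.conjTranspose * Z) i i).re := by
  have key := norm_inner_le_norm (𝕜 := ℂ) (WithLp.toLp 2 fun j => star (Y i j) : EuclideanSpace ℂ n)
    (WithLp.toLp 2 fun j => Z j i)
  have h1 : inner ℂ (WithLp.toLp 2 fun j => star (Y i j) : EuclideanSpace ℂ n)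
      (WithLp.toLp 2 fun j => Z j i) = (Y * Z) i i := by
    simp [PiLp.inner_apply, Matrix.mul_apply, mul_comm]
  have h2 : ‖(WithLp.toLp 2 fun j => star (Y i j) : EuclideanSpace ℂ n)‖ =
      √((Y * Y.conjTranspose) i i).re := by
    rw [EuclideanSpace.norm_eq]
    congr 1
    rw [Matrix.mul_apply, Complex.re_sum]
    refine Finset.sum_congr rfl fun j _ => ?_
    simp [Complex.mul_conj, Complex.normSq_eq_norm_sq, -Complex.ofReal_pow]
  have h3 : ‖(WithLp.toLp 2 fun j => Z j i : EuclideanSpace ℂ n)‖ =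
      √((Z.conjTranspose * Z) i i).re := by
    rw [EuclideanSpace.norm_eq]
    congr 1
    rw [Matrix.mul_apply, Complex.re_sum]
    refine Finset.sum_congr rfl fun j _ => ?_
    simp [mul_comm, Complex.mul_conj, Complex.normSq_eq_norm_sq, -Complex.ofReal_pow]
  rw [h1, h2, h3] at key
  exact (Complex.re_le_norm _).trans key

lemma vecMulVec_self_mul_self {φ : n → ℂ} (hφ : star φ ⬝ᵥ φ = 1) :
    Matrix.vecMulVec φ (star φ) * Matrix.vecMulVec φ (star φ) = Matrix.vecMulVec φ (star φ) := by
  rw [Matrix.vecMulVec_mul_vecMulVec, hφ, one_smul]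

lemma trace_vecMulVec_mul (φ : n → ℂ) (X : Matrix n n ℂ) :
    (Matrix.vecMulVec φ (star φ) * X).trace = star φ ⬝ᵥ X.mulVec φ := by
  rw [Matrix.trace_mul_comm, Matrix.mul_vecMulVec, Matrix.trace_vecMulVec, dotProduct_comm]

variable [DecidableEq n]

lemma sqrt_posSemidef (X : Matrix n n ℂ) : (CFC.sqrt X).PosSemidef :=
  Matrix.nonneg_iff_posSemidef.mp (CFC.sqrt_nonneg X)

lemma sqrt_mul_sqrt {X : Matrix n n ℂ} (hX : X.PosSemidef) : CFC.sqrt X * CFC.sqrt X = X :=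
  CFC.sqrt_mul_sqrt_self X (Matrix.nonneg_iff_posSemidef.mpr hX)

lemma sqrt_eq_of_mul_self {X Q : Matrix n n ℂ} (hQ : Q.PosSemidef) (h : Q * Q = X) :
    CFC.sqrt X = Q :=
  CFC.sqrt_unique h (Matrix.nonneg_iff_posSemidef.mpr hQ)

lemma traceNorm_eq_of_mul_self {X Q : Matrix n n ℂ} (hQ : Q.PosSemidef)
    (h : Q * Q = X.conjTranspose * X) : traceNorm X = Q.trace.re := by
  rw [traceNorm, sqrt_eq_of_mul_self hQ h]

lemma fidelity_nonneg (ω τ : Matrix n n ℂ) : 0 ≤ fidelity ω τ := sq_nonneg _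

lemma traceNorm_smul {c : ℝ} (hc : 0 ≤ c) (X : Matrix n n ℂ) :
    traceNorm ((c : ℂ) • X) = c * traceNorm X := by
  have hQ := sqrt_posSemidef (X.conjTranspose * X)
  have hc' : (0 : ℂ) ≤ (c : ℂ) := by exact_mod_cast hc
  rw [traceNorm_eq_of_mul_self (hQ.smul hc')]
  · rw [Matrix.trace_smul, traceNorm, smul_eq_mul, Complex.re_ofReal_mul]
  · rw [Matrix.smul_mul, Matrix.mul_smul,
      sqrt_mul_sqrt (Matrix.posSemidef_conjTranspose_mul_self X),
      Matrix.conjTranspose_smul, Matrix.smul_mul, Matrix.mul_smul]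
    simp

lemma exists_spectral {X : Matrix n n ℂ} (hX : X.IsHermitian) :
    ∃ (U : Matrix n n ℂ) (s : n → ℝ), U.conjTranspose * U = 1 ∧ U * U.conjTranspose = 1 ∧
      X = U * Matrix.diagonal (fun i => (s i : ℂ)) * U.conjTranspose := by
  refine ⟨hX.eigenvectorUnitary, hX.eigenvalues, ?_, ?_, ?_⟩
  · exact (Matrix.mem_unitaryGroup_iff').mp hX.eigenvectorUnitary.2
  · exact (Matrix.mem_unitaryGroup_iff).mp hX.eigenvectorUnitary.2
  · exact hX.spectral_theorem

lemma diagonal_eq_of_spectral {X U : Matrix n n ℂ} {s : n → ℝ} (hU : U.conjTranspose * U = 1)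
    (h : X = U * Matrix.diagonal (fun i => (s i : ℂ)) * U.conjTranspose) :
    U.conjTranspose * X * U = Matrix.diagonal (fun i => (s i : ℂ)) := by
  rw [h, show U.conjTranspose * (U * Matrix.diagonal (fun i => (s i : ℂ)) * U.conjTranspose) * U =
    (U.conjTranspose * U) * Matrix.diagonal (fun i => (s i : ℂ)) * (U.conjTranspose * U) by
      simp only [Matrix.mul_assoc], hU, Matrix.one_mul, Matrix.mul_one]

/-- If `Xᴴ X` has eigenvalues `t i ^ 2` with `t i ≥ 0`, then `‖X‖₁ = ∑ t i`. -/
lemma traceNorm_eq_sum {X U : Matrix n n ℂ} {t : n → ℝ} (ht : ∀ i, 0 ≤ t i)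
    (hU : U.conjTranspose * U = 1)
    (h : X.conjTranspose * X =
      U * Matrix.diagonal (fun i => ((t i ^ 2 : ℝ) : ℂ)) * U.conjTranspose) :
    traceNorm X = ∑ i, t i := by
  have hD : (Matrix.diagonal (fun i => (t i : ℂ))).PosSemidef :=
    Matrix.posSemidef_diagonal_iff.mpr fun i => by exact_mod_cast ht i
  rw [traceNorm_eq_of_mul_self (hD.mul_mul_conjTranspose_same U)]
  · rw [Matrix.trace_mul_comm, ← Matrix.mul_assoc, hU, Matrix.one_mul, Matrix.trace_diagonal]
    simp
  · rw [h, show U * Matrix.diagonal (fun i => (t i : ℂ)) * U.conjTranspose *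
      (U * Matrix.diagonal (fun i => (t i : ℂ)) * U.conjTranspose) =
      U * (Matrix.diagonal (fun i => (t i : ℂ)) * (U.conjTranspose * U) *
        Matrix.diagonal (fun i => (t i : ℂ))) * U.conjTranspose by
      simp only [Matrix.mul_assoc], hU, Matrix.mul_one, Matrix.diagonal_mul_diagonal]
    simp [pow_two]

lemma trace_re_conj {U : Matrix n n ℂ} (hU : U * U.conjTranspose = 1) (X : Matrix n n ℂ) :
    ∑ i, ((U.conjTranspose * X * U) i i).re = X.trace.re := by
  have : (U.conjTranspose * X * U).trace = X.trace := by
    rw [Matrix.trace_mul_comm, ← Matrix.mul_assoc, hU, Matrix.one_mul]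
  rw [← this, Matrix.trace, Complex.re_sum]
  rfl

/-- In an eigenbasis of `ρ - τ`, each eigenvalue is a difference of diagonal entries of `ρ` and
`τ`. -/
lemma traceNorm_sub_le {ρ τ : Matrix n n ℂ} (hρ : ρ.PosSemidef) (hτ : τ.PosSemidef) :
    traceNorm (ρ - τ) ≤ ρ.trace.re + τ.trace.re := by
  have hΔ : (ρ - τ).IsHermitian := hρ.isHermitian.sub hτ.isHermitian
  obtain ⟨U, s, hU, hU', h⟩ := exists_spectral hΔ
  have hsq : (ρ - τ).conjTranspose * (ρ - τ) =
      U * Matrix.diagonal (fun i => ((|s i| ^ 2 : ℝ) : ℂ)) * U.conjTranspose := by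
    rw [hΔ.eq, h, show U * Matrix.diagonal (fun i => (s i : ℂ)) * U.conjTranspose *
      (U * Matrix.diagonal (fun i => (s i : ℂ)) * U.conjTranspose) =
      U * (Matrix.diagonal (fun i => (s i : ℂ)) * (U.conjTranspose * U) *
        Matrix.diagonal (fun i => (s i : ℂ))) * U.conjTranspose by
      simp only [Matrix.mul_assoc], hU, Matrix.mul_one, Matrix.diagonal_mul_diagonal]
    simp only [sq_abs]
    simp [pow_two]
  rw [traceNorm_eq_sum (fun i => abs_nonneg (s i)) hU hsq, ← trace_re_conj hU' ρ,
    ← trace_re_conj hU' τ, ← Finset.sum_add_distrib]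
  refine Finset.sum_le_sum fun i _ => ?_
  have hd := congrFun (congrFun (diagonal_eq_of_spectral hU h) i) i
  rw [Matrix.diagonal_apply_eq, Matrix.mul_sub, Matrix.sub_mul, Matrix.sub_apply] at hd
  have hd' := congrArg Complex.re hd
  rw [Complex.sub_re, Complex.ofReal_re] at hd'
  have h1 := (Complex.le_def.mp ((hρ.conjTranspose_mul_mul_same U).diag_nonneg (i := i))).1
  have h2 := (Complex.le_def.mp ((hτ.conjTranspose_mul_mul_same U).diag_nonneg (i := i))).1
  rw [Complex.zero_re] at h1 h2
  rw [abs_le]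
  constructor <;> linarith

/-- The variational lower bound `Re Tr(M X) ≤ ‖X‖₁` for unitary `M`. -/
lemma re_trace_mul_le_traceNorm {M : Matrix n n ℂ} (hM : M * M.conjTranspose = 1)
    (X : Matrix n n ℂ) : (M * X).trace.re ≤ traceNorm X := by
  -- In an eigenbasis `u_i` of `Xᴴ X`, each `⟨u_i, M X u_i⟩` is at most `‖X u_i‖`, a singular value.
  have hX := Matrix.posSemidef_conjTranspose_mul_self X
  obtain ⟨U, s, hU, hU', h⟩ := exists_spectral hX.isHermitian
  have hd := diagonal_eq_of_spectral hU h
  have hs : ∀ i, 0 ≤ s i := fun i => by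
    have := (hX.conjTranspose_mul_mul_same U).diag_nonneg (i := i)
    rw [hd, Matrix.diagonal_apply_eq] at this
    exact_mod_cast this
  have hsum := traceNorm_eq_sum (X := X) (t := fun i => √(s i)) (fun i => Real.sqrt_nonneg _) hU
    (by rw [h]; simp only [Real.sq_sqrt (hs _)])
  rw [hsum, ← trace_re_conj hU' (M * X)]
  refine Finset.sum_le_sum fun i _ => ?_
  have key := re_mul_apply_le (U.conjTranspose * M) (X * U) i
  have e1 : (U.conjTranspose * M) * (U.conjTranspose * M).conjTranspose = 1 := by
    rw [Matrix.conjTranspose_mul, Matrix.conjTranspose_conjTranspose,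
      show U.conjTranspose * M * (M.conjTranspose * U) =
        U.conjTranspose * (M * M.conjTranspose) * U by simp only [Matrix.mul_assoc],
      hM, Matrix.mul_one, hU]
  have e2 : (X * U).conjTranspose * (X * U) = Matrix.diagonal (fun i => (s i : ℂ)) := by
    rw [← hd, Matrix.conjTranspose_mul]; simp only [Matrix.mul_assoc]
  rw [e1, e2, Matrix.one_apply_eq, Matrix.diagonal_apply_eq, Complex.one_re, Real.sqrt_one,
    one_mul, Complex.ofReal_re] at key
  simpa only [Matrix.mul_assoc] using key

section
open scoped Matrix.Norms.L2Operator

lemma sqrt_sub_sqrt_posSemidef {X Y : Matrix n n ℂ} (h : (Y - X).PosSemidef) :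
    (CFC.sqrt Y - CFC.sqrt X).PosSemidef :=
  Matrix.le_iff.mp (CFC.sqrt_le_sqrt X Y (Matrix.le_iff.mpr h))

end

lemma trace_mul_nonneg {X Y : Matrix n n ℂ} (hX : X.PosSemidef) (hY : Y.PosSemidef) :
    0 ≤ (X * Y).trace := by
  rw [← sqrt_mul_sqrt hX, Matrix.mul_assoc, Matrix.trace_mul_comm]
  have := (hY.mul_mul_conjTranspose_same (CFC.sqrt X)).trace_nonneg
  rwa [(sqrt_posSemidef X).isHermitian.eq] at this

/-- The fidelity of a state `ρ` with any `σ ≥ p ρ` is at least `p`, since the square root is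
operator monotone. -/
lemma le_fidelity {ρ σ : Matrix n n ℂ} (hρ : IsState ρ) {p : ℝ} (hp : 0 ≤ p)
    (h : (σ - (p : ℂ) • ρ).PosSemidef) : p ≤ fidelity ρ σ := by
  have h1 := sqrt_sub_sqrt_posSemidef h
  have hs : CFC.sqrt ((p : ℂ) • ρ) = ((√p : ℝ) : ℂ) • CFC.sqrt ρ := by
    refine sqrt_eq_of_mul_self ((sqrt_posSemidef ρ).smul (by exact_mod_cast Real.sqrt_nonneg p)) ?_
    rw [Matrix.smul_mul, Matrix.mul_smul, sqrt_mul_sqrt hρ.1, smul_smul, ← Complex.ofReal_mul,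
      Real.mul_self_sqrt hp]
  rw [hs] at h1
  have h2 := (Complex.le_def.mp (trace_mul_nonneg (sqrt_posSemidef ρ) h1)).1
  rw [Matrix.mul_sub, Matrix.mul_smul, sqrt_mul_sqrt hρ.1, Matrix.trace_sub, Matrix.trace_smul,
    hρ.2] at h2
  simp only [smul_eq_mul, mul_one, Complex.sub_re, Complex.ofReal_re, Complex.zero_re] at h2
  have h3 := re_trace_mul_le_traceNorm (M := 1) (by simp) (CFC.sqrt ρ * CFC.sqrt σ)
  rw [Matrix.one_mul] at h3
  have h4 : √p ≤ traceNorm (CFC.sqrt ρ * CFC.sqrt σ) := by linarith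
  calc p = √p ^ 2 := (Real.sq_sqrt hp).symm
    _ ≤ _ := by rw [fidelity]; gcongr

/-- The fidelity of a pure state with `τ` is at most the overlap. -/
lemma fidelity_pure_le {φ : n → ℂ} (hφ : star φ ⬝ᵥ φ = 1) {τ : Matrix n n ℂ}
    (hτ : τ.PosSemidef) :
    fidelity (Matrix.vecMulVec φ (star φ)) τ ≤ (star φ ⬝ᵥ τ.mulVec φ).re := by
  set Φ := Matrix.vecMulVec φ (star φ) with hΦ
  have hΦp : Φ.PosSemidef := Matrix.posSemidef_vecMulVec_self_star φ
  have hΦs : CFC.sqrt Φ = Φ := sqrt_eq_of_mul_self hΦp (vecMulVec_self_mul_self hφ)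
  have hS := (sqrt_posSemidef τ).isHermitian
  set w := (CFC.sqrt τ).mulVec φ with hw
  have hw0 : Matrix.vecMul (star φ) (CFC.sqrt τ) = star w := by
    rw [hw, Matrix.star_mulVec, hS.eq]
  have hX : (Φ * CFC.sqrt τ).conjTranspose * (Φ * CFC.sqrt τ) = Matrix.vecMulVec w (star w) := by
    rw [Matrix.conjTranspose_mul, hS.eq, hΦp.isHermitian.eq, show CFC.sqrt τ * Φ * (Φ * CFC.sqrt τ)
      = CFC.sqrt τ * (Φ * Φ) * CFC.sqrt τ by simp only [Matrix.mul_assoc],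
      vecMulVec_self_mul_self hφ, Matrix.mul_vecMulVec, Matrix.vecMulVec_mul, hw0]
  have hww : star w ⬝ᵥ w = star φ ⬝ᵥ τ.mulVec φ := by
    rw [← hw0, hw, ← Matrix.dotProduct_mulVec, Matrix.mulVec_mulVec, sqrt_mul_sqrt hτ]
  have hnn : 0 ≤ star φ ⬝ᵥ τ.mulVec φ := hτ.dotProduct_mulVec_nonneg φ
  obtain ⟨hr, hi⟩ := Complex.le_def.mp hnn
  set r := (star φ ⬝ᵥ τ.mulVec φ).re with hrdef
  have hr' : star w ⬝ᵥ w = (r : ℂ) := by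
    rw [hww]; exact Complex.ext rfl (by simpa using hi.symm)
  have hrn : 0 ≤ r := hr
  have hQ : ((((√r)⁻¹ : ℝ) : ℂ) • Matrix.vecMulVec w (star w)).PosSemidef :=
    (Matrix.posSemidef_vecMulVec_self_star w).smul
      (by exact_mod_cast inv_nonneg.mpr (Real.sqrt_nonneg r))
  have hQQ : ((((√r)⁻¹ : ℝ) : ℂ) • Matrix.vecMulVec w (star w)) *
      ((((√r)⁻¹ : ℝ) : ℂ) • Matrix.vecMulVec w (star w)) =
      (Φ * CFC.sqrt τ).conjTranspose * (Φ * CFC.sqrt τ) := by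
    rw [hX, Matrix.smul_mul, Matrix.mul_smul, Matrix.vecMulVec_mul_vecMulVec, hr',
      smul_smul, Matrix.vecMulVec_smul, smul_smul]
    -- For `r = 0` the factor is the junk value `0`, which is harmless as then `w = 0`.
    rcases hrn.eq_or_lt with h0 | h0
    · have : w = 0 := by
        rw [← h0, Complex.ofReal_zero] at hr'
        exact dotProduct_star_self_eq_zero.mp hr'
      simp [this]
    · have : (√r)⁻¹ * (√r)⁻¹ * r = 1 := by
        rw [← mul_inv, Real.mul_self_sqrt hrn, inv_mul_cancel₀ h0.ne']
      rw [← Complex.ofReal_mul, ← Complex.ofReal_mul, this, Complex.ofReal_one, one_smul]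
  rw [fidelity, hΦs, traceNorm_eq_of_mul_self hQ hQQ, Matrix.trace_smul, Matrix.trace_vecMulVec,
    dotProduct_comm, hr', smul_eq_mul, ← Complex.ofReal_mul, Complex.ofReal_re, mul_pow, inv_pow,
    Real.sq_sqrt hrn]
  rcases hrn.eq_or_lt with h0 | h0
  · simp [← h0]
  · exact le_of_eq (by field_simp)

/-- Testing with the reflection `2 |φ⟩⟨φ| - 1` bounds the trace distance from a pure state from
below. -/
lemma le_traceNorm_pure_sub {φ : n → ℂ} (hφ : star φ ⬝ᵥ φ = 1) {τ : Matrix n n ℂ}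
    (hτ : τ.trace = 1) :
    1 - (star φ ⬝ᵥ τ.mulVec φ).re ≤ 1 / 2 * traceNorm (Matrix.vecMulVec φ (star φ) - τ) := by
  set Φ := Matrix.vecMulVec φ (star φ) with hΦ
  have hΦΦ : Φ * Φ = Φ := vecMulVec_self_mul_self hφ
  have hΦh : Φ.conjTranspose = Φ := (Matrix.posSemidef_vecMulVec_self_star φ).isHermitian.eq
  have hΦt : Φ.trace = 1 := by rw [hΦ, Matrix.trace_vecMulVec, dotProduct_comm, hφ]
  have hM : ((2 : ℂ) • Φ - 1) * ((2 : ℂ) • Φ - 1).conjTranspose = 1 := by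
    rw [Matrix.conjTranspose_sub, Matrix.conjTranspose_smul, hΦh, Matrix.conjTranspose_one,
      show star (2 : ℂ) = 2 by simp, Matrix.sub_mul, Matrix.mul_sub, Matrix.smul_mul,
      Matrix.mul_smul, hΦΦ, Matrix.mul_one, Matrix.one_mul]
    module
  have h := re_trace_mul_le_traceNorm hM (Φ - τ)
  rw [Matrix.sub_mul, Matrix.one_mul, Matrix.smul_mul, Matrix.mul_sub, hΦΦ, Matrix.trace_sub,
    Matrix.trace_smul, Matrix.trace_sub, Matrix.trace_sub, trace_vecMulVec_mul, hΦt, hτ] at h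
  simp at h
  linarith

end TraceNorm

/-! ### Complete positivity and trace preservation -/

section Channels

variable {n m l : Type*}

lemma amplify_apply (k : ℕ) (N : Superop n m) (X : Matrix (Fin k × n) (Fin k × n) ℂ)
    (u v : Fin k × m) :
    amplify k N X u v = N (Matrix.of fun i j => X (u.1, i) (v.1, j)) u.2 v.2 := rfl

lemma amplify_add (k : ℕ) (N M : Superop n m) (X : Matrix (Fin k × n) (Fin k × n) ℂ) :
    amplify k (N + M) X = amplify k N X + amplify k M X := rfl

lemma amplify_smul (k : ℕ) (c : ℂ) (N : Superop n m) (X : Matrix (Fin k × n) (Fin k × n) ℂ) :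
    amplify k (c • N) X = c • amplify k N X := rfl

lemma amplify_id (k : ℕ) (X : Matrix (Fin k × n) (Fin k × n) ℂ) :
    amplify k (LinearMap.id : Superop n n) X = X := rfl

lemma IsCP.id : IsCP (LinearMap.id : Superop n n) := fun _ _ hX => hX

lemma IsCP.zero : IsCP (0 : Superop n m) := fun _ _ _ => Matrix.PosSemidef.zero

lemma IsCP.add {N M : Superop n m} (hN : IsCP N) (hM : IsCP M) : IsCP (N + M) :=
  fun k X hX => (hN k X hX).add (hM k X hX)

lemma IsCP.smul {N : Superop n m} (hN : IsCP N) {c : ℂ} (hc : 0 ≤ c) : IsCP (c • N) :=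
  fun k X hX => (hN k X hX).smul hc

lemma IsCP.sum {ι : Type*} (s : Finset ι) {N : ι → Superop n m} (hN : ∀ i ∈ s, IsCP (N i)) :
    IsCP (∑ i ∈ s, N i) := by
  classical
  induction s using Finset.induction_on with
  | empty => simpa using IsCP.zero
  | insert i s hi ih =>
    rw [Finset.sum_insert hi]
    exact (hN i (Finset.mem_insert_self i s)).add
      (ih fun j hj => hN j (Finset.mem_insert_of_mem hj))

lemma IsCP.comp {N : Superop m l} {M : Superop n m} (hN : IsCP N) (hM : IsCP M) :
    IsCP (N ∘ₗ M) := fun k X hX => hN k _ (hM k X hX)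

/-- The map `X ↦ V X V†` with a single Kraus operator `V`. -/
def krausMap [Fintype n] (V : Matrix m n ℂ) : Superop n m where
  toFun X := V * X * V.conjTranspose
  map_add' X Y := by rw [Matrix.mul_add, Matrix.add_mul]
  map_smul' c X := by rw [Matrix.mul_smul, Matrix.smul_mul, RingHom.id_apply]

lemma krausMap_apply [Fintype n] (V : Matrix m n ℂ) (X : Matrix n n ℂ) :
    krausMap V X = V * X * V.conjTranspose := rfl

lemma isCP_krausMap [Fintype n] [Fintype m] (V : Matrix m n ℂ) : IsCP (krausMap V) := by
  intro k X hX
  have h := hX.mul_mul_conjTranspose_same ((1 : Matrix (Fin k) (Fin k) ℂ) ⊗ₖ V)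
  convert h using 1
  ext u v
  simp [amplify_apply, krausMap_apply, Matrix.mul_apply, Fintype.sum_prod_type, Matrix.one_apply,
    Matrix.kroneckerMap_apply, Finset.sum_mul, apply_ite]

lemma IsTP.comp [Fintype n] [Fintype m] [Fintype l] {N : Superop m l} {M : Superop n m}
    (hN : IsTP N) (hM : IsTP M) : IsTP (N ∘ₗ M) :=
  fun X => (hN (M X)).trans (hM X)

lemma isChannel_krausMap [Fintype n] [DecidableEq n] {U : Matrix n n ℂ}
    (hU : U.conjTranspose * U = 1) : IsChannel (krausMap U) :=
  ⟨isCP_krausMap U, fun X => by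
    rw [krausMap_apply, Matrix.trace_mul_comm, ← Matrix.mul_assoc, hU, Matrix.one_mul]⟩

lemma trace_amplify [Fintype n] [Fintype m] {N : Superop n m} (hN : IsTP N) (k : ℕ)
    (X : Matrix (Fin k × n) (Fin k × n) ℂ) : (amplify k N X).trace = X.trace := by
  simp only [Matrix.trace, Matrix.diag, Fintype.sum_prod_type]
  refine Finset.sum_congr rfl fun i _ => ?_
  exact hN (Matrix.of fun p q => X (i, p) (i, q))

lemma IsChannel.isState_amplify [Fintype n] [Fintype m] {N : Superop n m} (hN : IsChannel N)
    (k : ℕ) {X : Matrix (Fin k × n) (Fin k × n) ℂ} (hX : IsState X) : IsState (amplify k N X) :=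
  ⟨hN.1 k X hX.1, (trace_amplify hN.2 k X).trans hX.2⟩

/-- The map `X ↦ (N Xᵀ)ᵀ`, a channel whenever `N` is one. -/
def transposeConj (N : Superop n m) : Superop n m where
  toFun X := (N X.transpose).transpose
  map_add' X Y := by simp
  map_smul' c X := by simp

lemma transposeConj_apply (N : Superop n m) (X : Matrix n n ℂ) :
    transposeConj N X = (N X.transpose).transpose := rfl

lemma transposeConj_transposeConj (N : Superop n m) : transposeConj (transposeConj N) = N := by
  ext1 X; simp [transposeConj_apply]

lemma IsChannel.transposeConj [Fintype n] [Fintype m] {N : Superop n m} (hN : IsChannel N) :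
    IsChannel (transposeConj N) :=
  ⟨fun k X hX => (hN.1 k _ hX.transpose).transpose, fun X => by
    rw [transposeConj_apply, Matrix.trace_transpose, hN.2, Matrix.trace_transpose]⟩

/-- Appending a fixed positive operator is completely positive. -/
lemma IsCP.simChannel {d : ℕ} {a b : Type*} [Fintype a] [Fintype b]
    {𝓛 : Superop (Fin d × (a × b)) (Fin d)} (h𝓛 : IsCP 𝓛) {τ : Matrix (a × b) (a × b) ℂ}
    (hτ : τ.PosSemidef) : IsCP (simChannel 𝓛 τ) := by
  intro k X hX
  have h := h𝓛 k _ ((hX.kronecker hτ).submatrix (Equiv.prodAssoc (Fin k) (Fin d) (a × b)).symm)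
  exact h

lemma simChannel_apply {d : ℕ} {a b : Type*} (𝓛 : Superop (Fin d × (a × b)) (Fin d))
    (τ : Matrix (a × b) (a × b) ℂ) (σ : Matrix (Fin d) (Fin d) ℂ) :
    simChannel 𝓛 τ σ = 𝓛 (σ ⊗ₖ τ) := rfl

lemma IsChannel.simChannel {d : ℕ} {a b : Type*} [Fintype a] [Fintype b]
    {𝓛 : Superop (Fin d × (a × b)) (Fin d)} (h𝓛 : IsChannel 𝓛) {τ : Matrix (a × b) (a × b) ℂ}
    (hτ : IsState τ) : IsChannel (simChannel 𝓛 τ) :=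
  ⟨h𝓛.1.simChannel hτ.1, fun X => by
    rw [simChannel_apply, h𝓛.2, Matrix.trace_kronecker, hτ.2, mul_one]⟩

/-- Maps on `A ⊗ ÂB̂` that agree on product operators are equal. -/
lemma ext_simChannel {d : ℕ} {a b : Type*} [Fintype a] [Fintype b] [DecidableEq a] [DecidableEq b]
    {𝓛 𝓜 : Superop (Fin d × (a × b)) (Fin d)}
    (h : ∀ τ : Matrix (a × b) (a × b) ℂ, simChannel 𝓛 τ = simChannel 𝓜 τ) : 𝓛 = 𝓜 := by
  refine Matrix.ext_linearMap _ fun u v => ?_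
  ext1
  have := congrArg (fun N => N (Matrix.single u.1 v.1 1)) (h (Matrix.single u.2 v.2 1))
  simpa [simChannel_apply, Matrix.single_kronecker_single] using this

end Channels

/-! ### One-way LOCC maps -/

section OneWay

variable {d : ℕ} {a b : Type*} [Fintype a] [Fintype b] [DecidableEq b]

/-- `aliceOutcome` as a linear map of the operator on `AÂB̂`. -/
def aliceMap (Λ : Matrix (Fin d × a) (Fin d × a) ℂ) : Superop (Fin d × (a × b)) b where
  toFun ω := aliceOutcome Λ ω
  map_add' X Y := by
    simp only [aliceOutcome, Matrix.submatrix_add, Pi.add_apply, Matrix.mul_add, map_add]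
  map_smul' c X := by
    simp only [aliceOutcome, Matrix.submatrix_smul, Pi.smul_apply, Matrix.mul_smul, map_smul,
      RingHom.id_apply]

lemma aliceMap_apply (Λ : Matrix (Fin d × a) (Fin d × a) ℂ)
    (ω : Matrix (Fin d × (a × b)) (Fin d × (a × b)) ℂ) : aliceMap Λ ω = aliceOutcome Λ ω := rfl

lemma aliceOutcome_apply (Λ : Matrix (Fin d × a) (Fin d × a) ℂ)
    (ω : Matrix (Fin d × (a × b)) (Fin d × (a × b)) ℂ) (p q : b) :
    aliceOutcome Λ ω p q =
      ∑ u : Fin d × a, ∑ v : Fin d × a, Λ u v * ω (v.1, v.2, p) (u.1, u.2, q) := by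
  simp [aliceOutcome, ptraceFst, Matrix.mul_apply, Fintype.sum_prod_type, Matrix.one_apply]

lemma aliceOutcome_add (Λ M : Matrix (Fin d × a) (Fin d × a) ℂ)
    (ω : Matrix (Fin d × (a × b)) (Fin d × (a × b)) ℂ) :
    aliceOutcome (Λ + M) ω = aliceOutcome Λ ω + aliceOutcome M ω := by
  ext p q
  simp [aliceOutcome_apply, add_mul, Finset.sum_add_distrib]

lemma aliceOutcome_smul (c : ℂ) (Λ : Matrix (Fin d × a) (Fin d × a) ℂ)
    (ω : Matrix (Fin d × (a × b)) (Fin d × (a × b)) ℂ) :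
    aliceOutcome (c • Λ) ω = c • aliceOutcome Λ ω := by
  ext p q
  simp [aliceOutcome_apply, mul_assoc, Finset.mul_sum]

lemma aliceOutcome_sum {ι : Type*} (s : Finset ι) (Λ : ι → Matrix (Fin d × a) (Fin d × a) ℂ)
    (ω : Matrix (Fin d × (a × b)) (Fin d × (a × b)) ℂ) :
    aliceOutcome (∑ i ∈ s, Λ i) ω = ∑ i ∈ s, aliceOutcome (Λ i) ω :=
  map_sum (AddMonoidHom.mk' (fun M => aliceOutcome M ω) fun M N => aliceOutcome_add M N ω) _ _

/-- The one-way LOCC map of a POVM and a family of channels. -/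
def oneWayMap {ι : Type*} [Fintype ι] (Λ : ι → Matrix (Fin d × a) (Fin d × a) ℂ)
    (𝒟 : ι → Superop b (Fin d)) : Superop (Fin d × (a × b)) (Fin d) :=
  ∑ x, 𝒟 x ∘ₗ aliceMap (Λ x)

lemma oneWayMap_apply {ι : Type*} [Fintype ι] (Λ : ι → Matrix (Fin d × a) (Fin d × a) ℂ)
    (𝒟 : ι → Superop b (Fin d)) (ω : Matrix (Fin d × (a × b)) (Fin d × (a × b)) ℂ) :
    oneWayMap Λ 𝒟 ω = ∑ x, 𝒟 x (aliceOutcome (Λ x) ω) := by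
  simp [oneWayMap, aliceMap_apply]

/-- The block `⟨p|ω|q⟩` on `AÂ` of an operator `ω` on `AÂB̂`. -/
def outcomeBlock (ω : Matrix (Fin d × (a × b)) (Fin d × (a × b)) ℂ) (p q : b) :
    Matrix (Fin d × a) (Fin d × a) ℂ :=
  Matrix.of fun u v => ω (u.1, u.2, p) (v.1, v.2, q)

lemma aliceOutcome_eq_trace (Λ : Matrix (Fin d × a) (Fin d × a) ℂ)
    (ω : Matrix (Fin d × (a × b)) (Fin d × (a × b)) ℂ) (p q : b) :
    aliceOutcome Λ ω p q = (Λ * outcomeBlock ω p q).trace := by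
  simp only [aliceOutcome_apply, Matrix.trace, Matrix.diag, Matrix.mul_apply, outcomeBlock,
    Matrix.of_apply]

lemma aliceOutcome_eq_sum_kraus (C : Matrix (Fin d × a) (Fin d × a) ℂ) :
    (aliceMap (C.conjTranspose * C) : Superop (Fin d × (a × b)) b) =
      ∑ u, krausMap (Matrix.of fun p w => if p = w.2.2 then C u (w.1, w.2.1) else 0) := by
  ext1 ω
  ext p q
  rw [aliceMap_apply, aliceOutcome_eq_trace, Matrix.mul_assoc, Matrix.trace_mul_comm,
    LinearMap.sum_apply, Matrix.sum_apply, Matrix.trace]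
  refine Finset.sum_congr rfl fun u _ => ?_
  simp [krausMap_apply, Matrix.mul_apply, Fintype.sum_prod_type, outcomeBlock, Finset.sum_mul,
    apply_ite]

variable [DecidableEq a]

lemma outcomeBlock_krausMap (V : Matrix (Fin d) (Fin d) ℂ)
    (ω : Matrix (Fin d × (a × b)) (Fin d × (a × b)) ℂ) (p q : b) :
    outcomeBlock (krausMap (V ⊗ₖ (1 : Matrix (a × b) (a × b) ℂ)) ω) p q =
      krausMap (V ⊗ₖ (1 : Matrix a a ℂ)) (outcomeBlock ω p q) := by
  ext u v
  simp [krausMap_apply, Matrix.mul_apply, Fintype.sum_prod_type, outcomeBlock, Finset.sum_mul,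
    Matrix.one_apply, apply_ite]

lemma trace_aliceOutcome_one (ω : Matrix (Fin d × (a × b)) (Fin d × (a × b)) ℂ) :
    (aliceOutcome (1 : Matrix (Fin d × a) (Fin d × a) ℂ) ω).trace = ω.trace := by
  simp only [Matrix.trace, Matrix.diag, aliceOutcome_apply, Matrix.one_apply, ite_mul, one_mul,
    zero_mul, Finset.sum_ite_eq, Finset.mem_univ, if_true, Fintype.sum_prod_type]
  rw [Finset.sum_comm]
  refine Finset.sum_congr rfl fun i _ => ?_
  rw [Finset.sum_comm]

lemma isCP_aliceMap {Λ : Matrix (Fin d × a) (Fin d × a) ℂ} (hΛ : Λ.PosSemidef) :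
    IsCP (aliceMap Λ : Superop (Fin d × (a × b)) b) := by
  have h : Λ = (CFC.sqrt Λ).conjTranspose * CFC.sqrt Λ := by
    rw [(sqrt_posSemidef Λ).isHermitian.eq, sqrt_mul_sqrt hΛ]
  rw [h, aliceOutcome_eq_sum_kraus]
  exact IsCP.sum _ fun u _ => isCP_krausMap _

/-- The outcomes of a one-way LOCC map may be labelled by any finite type. -/
lemma isOneWayLOCC_oneWayMap {ι : Type*} [Fintype ι]
    {Λ : ι → Matrix (Fin d × a) (Fin d × a) ℂ} {𝒟 : ι → Superop b (Fin d)} (hΛ : IsPOVM Λ)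
    (h𝒟 : ∀ x, IsChannel (𝒟 x)) : IsOneWayLOCC (oneWayMap Λ 𝒟) := by
  let e := (Fintype.equivFin ι).symm
  refine ⟨Fintype.card ι, Λ ∘ e, 𝒟 ∘ e, ⟨fun x => hΛ.1 _, ?_⟩, fun x => h𝒟 _, fun ω => ?_⟩
  · rw [← hΛ.2]; exact e.sum_comp Λ
  · rw [oneWayMap_apply]; exact (e.sum_comp fun x => 𝒟 x (aliceOutcome (Λ x) ω)).symm

lemma IsOneWayLOCC.exists_eq {𝓛 : Superop (Fin d × (a × b)) (Fin d)} (h : IsOneWayLOCC 𝓛) :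
    ∃ (r : ℕ) (Λ : Fin r → Matrix (Fin d × a) (Fin d × a) ℂ) (𝒟 : Fin r → Superop b (Fin d)),
      IsPOVM Λ ∧ (∀ x, IsChannel (𝒟 x)) ∧ 𝓛 = oneWayMap Λ 𝒟 := by
  obtain ⟨r, Λ, 𝒟, hΛ, h𝒟, h⟩ := h
  exact ⟨r, Λ, 𝒟, hΛ, h𝒟, LinearMap.ext fun ω => (h ω).trans (oneWayMap_apply Λ 𝒟 ω).symm⟩

lemma IsOneWayLOCC.isChannel {𝓛 : Superop (Fin d × (a × b)) (Fin d)} (h : IsOneWayLOCC 𝓛) :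
    IsChannel 𝓛 := by
  obtain ⟨r, Λ, 𝒟, hΛ, h𝒟, rfl⟩ := h.exists_eq
  refine ⟨IsCP.sum _ fun x _ => (h𝒟 x).1.comp (isCP_aliceMap (hΛ.1 x)), fun ω => ?_⟩
  rw [oneWayMap_apply, Matrix.trace_sum, Finset.sum_congr rfl fun x _ => (h𝒟 x).2 _,
    ← Matrix.trace_sum, ← aliceOutcome_sum, hΛ.2, trace_aliceOutcome_one]

/-- One-way LOCC maps are convex: Alice draws `i` at random and sends it along with her outcome. -/
lemma IsOneWayLOCC.sum_smul {ι : Type*} [Fintype ι] {𝓛 : ι → Superop (Fin d × (a × b)) (Fin d)}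
    (h𝓛 : ∀ i, IsOneWayLOCC (𝓛 i)) {w : ι → ℝ} (hw : ∀ i, 0 ≤ w i) (hw1 : ∑ i, w i = 1) :
    IsOneWayLOCC (∑ i, (w i : ℂ) • 𝓛 i) := by
  choose r Λ 𝒟 hΛ h𝒟 h using fun i => (h𝓛 i).exists_eq
  have key : ∑ i, (w i : ℂ) • 𝓛 i = oneWayMap (fun x : Σ i, Fin (r i) => (w x.1 : ℂ) • Λ x.1 x.2)
      (fun x => 𝒟 x.1 x.2) := by
    ext1 ω
    simp only [h, LinearMap.sum_apply, LinearMap.smul_apply, oneWayMap_apply, Fintype.sum_sigma,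
      aliceOutcome_smul, map_smul, Finset.smul_sum]
  rw [key]
  refine isOneWayLOCC_oneWayMap ⟨fun x => (hΛ x.1).1 x.2 |>.smul (by exact_mod_cast hw x.1), ?_⟩
    fun x => h𝒟 x.1 x.2
  simp only [Fintype.sum_sigma, ← Finset.smul_sum, (hΛ _).2]
  rw [← Finset.sum_smul, ← Complex.ofReal_sum, hw1, Complex.ofReal_one, one_smul]

lemma IsOneWayLOCC.add_smul {𝓛 𝓜 : Superop (Fin d × (a × b)) (Fin d)} (h𝓛 : IsOneWayLOCC 𝓛)
    (h𝓜 : IsOneWayLOCC 𝓜) {s t : ℝ} (hs : 0 ≤ s) (ht : 0 ≤ t) (hst : s + t = 1) :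
    IsOneWayLOCC ((s : ℂ) • 𝓛 + (t : ℂ) • 𝓜) := by
  have h := IsOneWayLOCC.sum_smul (𝓛 := ![𝓛, 𝓜]) (w := ![s, t])
    (by simp [Fin.forall_fin_two, h𝓛, h𝓜]) (by simp [Fin.forall_fin_two, hs, ht])
    (by simp [hst])
  simpa using h

/-- The map `ω ↦ U 𝓛((U† ⊗ 1) ω (U ⊗ 1)) U†`. -/
def conjMap (U : Matrix (Fin d) (Fin d) ℂ) (𝓛 : Superop (Fin d × (a × b)) (Fin d)) :
    Superop (Fin d × (a × b)) (Fin d) :=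
  krausMap U ∘ₗ 𝓛 ∘ₗ krausMap (U.conjTranspose ⊗ₖ (1 : Matrix (a × b) (a × b) ℂ))

lemma simChannel_conjMap (U : Matrix (Fin d) (Fin d) ℂ) (𝓛 : Superop (Fin d × (a × b)) (Fin d))
    (τ : Matrix (a × b) (a × b) ℂ) :
    simChannel (conjMap U 𝓛) τ = krausMap U ∘ₗ simChannel 𝓛 τ ∘ₗ krausMap U.conjTranspose := by
  ext1 σ
  simp [simChannel_apply, conjMap, krausMap_apply, Matrix.conjTranspose_kronecker,
    ← Matrix.mul_kronecker_mul]

lemma aliceMap_comp_kraus (U : Matrix (Fin d) (Fin d) ℂ) (Λ : Matrix (Fin d × a) (Fin d × a) ℂ) :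
    (aliceMap Λ ∘ₗ krausMap (U.conjTranspose ⊗ₖ (1 : Matrix (a × b) (a × b) ℂ)) :
      Superop (Fin d × (a × b)) b) =
    aliceMap ((U ⊗ₖ (1 : Matrix a a ℂ)) * Λ * (U ⊗ₖ (1 : Matrix a a ℂ)).conjTranspose) := by
  ext1 ω
  ext p q
  rw [LinearMap.comp_apply, aliceMap_apply, aliceMap_apply, aliceOutcome_eq_trace,
    aliceOutcome_eq_trace, outcomeBlock_krausMap, krausMap_apply, ← Matrix.mul_assoc,
    Matrix.trace_mul_comm]
  simp only [Matrix.conjTranspose_kronecker, Matrix.conjTranspose_conjTranspose,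
    Matrix.conjTranspose_one, Matrix.mul_assoc]

/-- One-way LOCC maps are closed under unitary conjugation. -/
lemma IsOneWayLOCC.conjMap {𝓛 : Superop (Fin d × (a × b)) (Fin d)} (h𝓛 : IsOneWayLOCC 𝓛)
    {U : Matrix (Fin d) (Fin d) ℂ} (hU : U.conjTranspose * U = 1) :
    IsOneWayLOCC (conjMap U 𝓛) := by
  obtain ⟨r, Λ, 𝒟, hΛ, h𝒟, rfl⟩ := h𝓛.exists_eq
  have hU' : U * U.conjTranspose = 1 := mul_eq_one_comm.mp hU
  have key : Teleport.conjMap U (oneWayMap Λ 𝒟) = oneWayMap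
      (fun x => (U ⊗ₖ (1 : Matrix a a ℂ)) * Λ x * (U ⊗ₖ (1 : Matrix a a ℂ)).conjTranspose)
      (fun x => krausMap U ∘ₗ 𝒟 x) := by
    ext1 ω
    simp only [oneWayMap, ← aliceMap_comp_kraus]
    simp only [Teleport.conjMap, LinearMap.comp_apply, LinearMap.sum_apply, map_sum]
  rw [key]
  refine isOneWayLOCC_oneWayMap ⟨fun x => (hΛ.1 x).mul_mul_conjTranspose_same _, ?_⟩
    fun x => ⟨(isCP_krausMap U).comp (h𝒟 x).1, (isChannel_krausMap hU).2.comp (h𝒟 x).2⟩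
  rw [← Finset.sum_mul, ← Finset.mul_sum, hΛ.2, Matrix.mul_one, Matrix.conjTranspose_kronecker,
    ← Matrix.mul_kronecker_mul, hU', Matrix.conjTranspose_one, Matrix.one_mul,
    Matrix.one_kronecker_one]

lemma exists_isChannel (hd : 0 < d) : ∃ N : Superop b (Fin d), IsChannel N := by
  let V : b → Matrix (Fin d) b ℂ := fun q => Matrix.single ⟨0, hd⟩ q 1
  refine ⟨∑ q, krausMap (V q), IsCP.sum _ fun q _ => isCP_krausMap _, fun X => ?_⟩
  simp [V, krausMap_apply, Matrix.trace_sum, Matrix.trace_single_eq_same]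
  rfl

lemma exists_isOneWayLOCC (hd : 0 < d) :
    ∃ 𝓛 : Superop (Fin d × (a × b)) (Fin d), IsOneWayLOCC 𝓛 := by
  obtain ⟨N, hN⟩ := exists_isChannel (b := b) hd
  exact ⟨_, isOneWayLOCC_oneWayMap (ι := Unit) (Λ := fun _ => 1) (𝒟 := fun _ => N)
    ⟨fun _ => Matrix.PosSemidef.one, by simp⟩ fun _ => hN⟩

end OneWay

/-! ### The discrete Fourier transform and the Heisenberg–Weyl operators -/

section HeisenbergWeyl

variable {d : ℕ}

/-- The character `e^{2πikz/d}` of `ℤ/d`. -/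
def phase (d : ℕ) (k z : Fin d) : ℂ :=
  Complex.exp (2 * Real.pi * Complex.I * ((k : ℕ) : ℂ) * ((z : ℕ) : ℂ) / (d : ℂ))

lemma phase_eq_pow (k z : Fin d) :
    phase d k z = (Complex.exp (2 * Real.pi * Complex.I / d) ^ (k : ℕ)) ^ (z : ℕ) := by
  rw [phase, ← pow_mul, ← Complex.exp_nat_mul]
  congr 1
  push_cast
  ring

lemma norm_phase (k z : Fin d) : ‖phase d k z‖ = 1 := by
  have : 2 * Real.pi * Complex.I * ((k : ℕ) : ℂ) * ((z : ℕ) : ℂ) / (d : ℂ) =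
      ((2 * Real.pi * (k : ℕ) * (z : ℕ) / d : ℝ) : ℂ) * Complex.I := by
    push_cast; ring
  rw [phase, this, Complex.norm_exp_ofReal_mul_I]

lemma sum_phase_mul_star (hd : 0 < d) (j l : Fin d) :
    ∑ z, phase d j z * star (phase d l z) = if j = l then (d : ℂ) else 0 := by
  have hnorm : ∀ z, phase d j z * star (phase d j z) = 1 := fun z => by
    rw [Complex.star_def, Complex.mul_conj, Complex.normSq_eq_norm_sq, norm_phase]; simp
  split_ifs with h
  · subst h
    simp only [hnorm]
    simp
  · have hζ := Complex.isPrimitiveRoot_exp d hd.ne'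
    set ζ := Complex.exp (2 * Real.pi * Complex.I / d) with hζdef
    have hw : ∀ z, phase d j z * star (phase d l z) =
        (ζ ^ (j : ℕ) * star (ζ ^ (l : ℕ))) ^ (z : ℕ) :=
      fun z => by rw [phase_eq_pow, phase_eq_pow, mul_pow, star_pow _ (z : ℕ)]
    have hn : ‖ζ‖ = 1 := hζ.norm'_eq_one hd.ne'
    have hinv : star (ζ ^ (l : ℕ)) * ζ ^ (l : ℕ) = 1 := by
      rw [mul_comm, Complex.star_def, Complex.mul_conj, Complex.normSq_eq_norm_sq, norm_pow, hn]
      simp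
    have hne : ζ ^ (j : ℕ) * star (ζ ^ (l : ℕ)) ≠ 1 := by
      intro h1
      apply h
      have h2 : ζ ^ (j : ℕ) = ζ ^ (l : ℕ) := by
        have := congrArg (· * ζ ^ (l : ℕ)) h1
        simpa only [mul_assoc, hinv, mul_one, one_mul] using this
      exact Fin.ext (hζ.pow_inj j.2 l.2 h2)
    have hpow : (ζ ^ (j : ℕ) * star (ζ ^ (l : ℕ))) ^ d = 1 := by
      rw [mul_pow, ← star_pow, ← pow_mul, ← pow_mul, mul_comm (j : ℕ), mul_comm (l : ℕ), pow_mul,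
        pow_mul, hζ.pow_eq_one]
      simp
    simp only [hw]
    rw [Fin.sum_univ_eq_sum_range fun z => (ζ ^ (j : ℕ) * star (ζ ^ (l : ℕ))) ^ z]
    have := mul_geom_sum (ζ ^ (j : ℕ) * star (ζ ^ (l : ℕ))) d
    rw [hpow, sub_self] at this
    exact (mul_eq_zero.mp this).resolve_left (sub_ne_zero.mpr hne)

lemma sqrt_inv_mul_self : (((√(d : ℝ))⁻¹ : ℝ) : ℂ) * (((√(d : ℝ))⁻¹ : ℝ) : ℂ) = (d : ℂ)⁻¹ := by
  rw [← Complex.ofReal_mul, ← mul_inv, Real.mul_self_sqrt (Nat.cast_nonneg d)]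
  simp

/-- The discrete Fourier transform, a unitary all of whose entries have modulus `1 / √d`. -/
def fourier (d : ℕ) : Matrix (Fin d) (Fin d) ℂ :=
  Matrix.of fun j k => (((√(d : ℝ))⁻¹ : ℝ) : ℂ) * phase d j k

lemma fourier_mul_conjTranspose (hd : 0 < d) : fourier d * (fourier d).conjTranspose = 1 := by
  have hd' : (d : ℂ) ≠ 0 := by exact_mod_cast hd.ne'
  ext j l
  have : ∀ z, fourier d j z * (fourier d).conjTranspose z l =
      (d : ℂ)⁻¹ * (phase d j z * star (phase d l z)) := fun z => by
    rw [← sqrt_inv_mul_self]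
    simp only [fourier, Matrix.conjTranspose_apply, Matrix.of_apply, star_mul', Complex.star_def,
      Complex.conj_ofReal]
    ring
  rw [Matrix.mul_apply, Finset.sum_congr rfl fun z _ => this z, ← Finset.mul_sum,
    sum_phase_mul_star hd, Matrix.one_apply]
  split_ifs <;> simp [hd']

lemma fourier_mul_star (j k : Fin d) : fourier d j k * star (fourier d j k) = (d : ℂ)⁻¹ := by
  rw [Complex.star_def, Complex.mul_conj, Complex.normSq_eq_norm_sq, fourier, Matrix.of_apply,
    norm_mul, norm_phase, Complex.norm_real, Real.norm_of_nonneg (by positivity), mul_one, inv_pow,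
    Real.sq_sqrt (Nat.cast_nonneg d)]
  simp

lemma hwX_apply [NeZero d] (x j k : Fin d) : hwX d x j k = if j = k + x then 1 else 0 := by
  rw [hwX, Matrix.of_apply]
  congr 1
  rw [Fin.ext_iff, Fin.val_add]

lemma hwX_conj_apply [NeZero d] (σ : Matrix (Fin d) (Fin d) ℂ) (x j l : Fin d) :
    (hwX d x * σ * (hwX d x).conjTranspose) j l = σ (j - x) (l - x) := by
  have h : ∀ j k x : Fin d, j = k + x ↔ k = j - x := fun j k x => by
    rw [eq_sub_iff_add_eq, eq_comm]
  simp [Matrix.mul_apply, hwX_apply, h, apply_ite]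

lemma hwW_conj_apply [NeZero d] (σ : Matrix (Fin d) (Fin d) ℂ) (zx : Fin d × Fin d) (j l : Fin d) :
    (hwW d zx * σ * (hwW d zx).conjTranspose) j l =
      phase d j zx.1 * star (phase d l zx.1) * σ (j - zx.2) (l - zx.2) := by
  rw [← hwX_conj_apply σ zx.2 j l, hwW, Matrix.conjTranspose_mul,
    show hwZ d zx.1 * hwX d zx.2 * σ * ((hwX d zx.2).conjTranspose * (hwZ d zx.1).conjTranspose) =
      hwZ d zx.1 * (hwX d zx.2 * σ * (hwX d zx.2).conjTranspose) * (hwZ d zx.1).conjTranspose by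
      simp only [Matrix.mul_assoc]]
  rw [hwZ, Matrix.diagonal_conjTranspose, Matrix.mul_diagonal, Matrix.diagonal_mul]
  simp only [phase, Pi.star_apply]
  ring

/-- Averaging over all Heisenberg–Weyl operators is completely depolarizing. -/
lemma sum_hwW_conj (hd : 0 < d) (σ : Matrix (Fin d) (Fin d) ℂ) :
    ∑ zx : Fin d × Fin d, hwW d zx * σ * (hwW d zx).conjTranspose =
      ((d : ℂ) * σ.trace) • (1 : Matrix (Fin d) (Fin d) ℂ) := by
  have : NeZero d := ⟨hd.ne'⟩
  ext j l
  simp only [Matrix.sum_apply, hwW_conj_apply, Fintype.sum_prod_type_right]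
  simp only [← Finset.sum_mul, sum_phase_mul_star hd, ← Finset.mul_sum]
  rw [Matrix.smul_apply, Matrix.one_apply]
  split_ifs with h
  · subst h
    rw [smul_eq_mul, mul_one, Matrix.trace]
    congr 1
    exact (Equiv.subLeft j).sum_comp fun k => σ k k
  · simp

lemma randomizing_apply (hd : 0 < d) (σ : Matrix (Fin d) (Fin d) ℂ) :
    randomizing d σ =
      (1 / ((d : ℂ) ^ 2 - 1)) • (((d : ℂ) * σ.trace) • (1 : Matrix (Fin d) (Fin d) ℂ) - σ) := by
  have : NeZero d := ⟨hd.ne'⟩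
  change (1 / ((d : ℂ) ^ 2 - 1)) •
    ∑ zx : Fin d × Fin d with ¬ ((zx.1 : ℕ) = 0 ∧ (zx.2 : ℕ) = 0),
      hwW d zx * σ * (hwW d zx).conjTranspose = _
  congr 1
  rw [← sum_hwW_conj hd, eq_sub_iff_add_eq,
    ← Finset.sum_filter_add_sum_filter_not Finset.univ
      (fun zx : Fin d × Fin d => ¬ ((zx.1 : ℕ) = 0 ∧ (zx.2 : ℕ) = 0))]
  congr 1
  have h : (Finset.univ.filter fun zx : Fin d × Fin d =>
      ¬ ¬ ((zx.1 : ℕ) = 0 ∧ (zx.2 : ℕ) = 0)) = {(0, 0)} := by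
    ext ⟨z, x⟩
    simp only [Finset.mem_filter, not_not, Finset.mem_univ, true_and, Finset.mem_singleton,
      Prod.mk.injEq, Fin.ext_iff, Fin.val_zero]
  rw [h, Finset.sum_singleton]
  ext j l
  rw [hwW_conj_apply]
  simp [phase]

/-- The randomizing map is a channel. -/
lemma isChannel_randomizing (hd : 2 ≤ d) : IsChannel (randomizing d) := by
  have hd0 : 0 < d := by omega
  have hpos : (0 : ℝ) < (d : ℝ) ^ 2 - 1 := by
    have : (2 : ℝ) ≤ d := by exact_mod_cast hd
    nlinarith
  have hne : (d : ℂ) ^ 2 - 1 ≠ 0 := by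
    have := hpos.ne'
    exact_mod_cast this
  constructor
  · have h : randomizing d = (1 / ((d : ℂ) ^ 2 - 1)) •
        ∑ zx : Fin d × Fin d with ¬ ((zx.1 : ℕ) = 0 ∧ (zx.2 : ℕ) = 0), krausMap (hwW d zx) := by
      ext1 σ
      simp [LinearMap.sum_apply, krausMap_apply, randomizing]
    rw [h]
    refine (IsCP.sum _ fun zx _ => isCP_krausMap _).smul ?_
    have : (1 / ((d : ℂ) ^ 2 - 1)) = ((1 / ((d : ℝ) ^ 2 - 1) : ℝ) : ℂ) := by push_cast; rfl
    rw [this]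
    exact_mod_cast (one_div_pos.mpr hpos).le
  · intro σ
    rw [randomizing_apply hd0, Matrix.trace_smul, Matrix.trace_sub, Matrix.trace_smul,
      Matrix.trace_one, Fintype.card_fin, smul_eq_mul, smul_eq_mul]
    field_simp

end HeisenbergWeyl

/-! ### The covariant map on product operators -/

section Covariant

variable {d : ℕ} {a b : Type*} [Fintype a] [Fintype b]

lemma simChannel_measureOut (K τ : Matrix (a × b) (a × b) ℂ) :
    simChannel (measureOut d K) τ = (K * τ).trace • (LinearMap.id : Superop (Fin d) (Fin d)) := by
  ext1 σ
  change ptraceSnd (Fin d) (a × b) (((1 : Matrix (Fin d) (Fin d) ℂ) ⊗ₖ K) * (σ ⊗ₖ τ)) = _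
  rw [← Matrix.mul_kronecker_mul, Matrix.one_mul]
  ext i j
  simp [ptraceSnd, Matrix.trace, ← Finset.mul_sum, mul_comm]

lemma simChannel_covariantMap (K L τ : Matrix (a × b) (a × b) ℂ) :
    simChannel (covariantMap d K L) τ =
      (K * τ).trace • (LinearMap.id : Superop (Fin d) (Fin d)) +
        (L * τ).trace • randomizing d := by
  have h : simChannel (covariantMap d K L) τ =
      simChannel (measureOut d K) τ + randomizing d ∘ₗ simChannel (measureOut d L) τ := rfl
  rw [h, simChannel_measureOut, simChannel_measureOut, LinearMap.comp_smul, LinearMap.comp_id]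

end Covariant

/-! ### A finite twirl onto isotropic maps -/

section Twirl

variable {d : ℕ}

/-- The conjugate `σ ↦ U N(U† σ U) U†` of a map `N` by `U`. -/
def conjSuperop (U : Matrix (Fin d) (Fin d) ℂ) (N : Superop (Fin d) (Fin d)) :
    Superop (Fin d) (Fin d) :=
  krausMap U ∘ₗ N ∘ₗ krausMap U.conjTranspose

lemma conjSuperop_apply (U : Matrix (Fin d) (Fin d) ℂ) (N : Superop (Fin d) (Fin d))
    (σ : Matrix (Fin d) (Fin d) ℂ) :
    conjSuperop U N σ = U * N (U.conjTranspose * σ * U) * U.conjTranspose := by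
  simp [conjSuperop, krausMap_apply]

/-- The unnormalized trace `Tr N(1)`. -/
def unitTrace (N : Superop (Fin d) (Fin d)) : ℂ := (N 1).trace

/-- The entanglement functional `∑_{i,j} ⟨i|N(|i⟩⟨j|)|j⟩`, which is `d²` times the entanglement
fidelity of `N`. It is the trace of `N` as an endomorphism of the space of operators. -/
def entTrace (N : Superop (Fin d) (Fin d)) : ℂ := ∑ i, ∑ j, N (Matrix.single i j 1) i j

/-- The functional `∑_i ⟨i|N(|i⟩⟨i|)|i⟩`. -/
def diagTrace (N : Superop (Fin d) (Fin d)) : ℂ := ∑ i, N (Matrix.single i i 1) i i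

lemma entTrace_eq_trace (N : Superop (Fin d) (Fin d)) : entTrace N = LinearMap.trace ℂ _ N := by
  rw [LinearMap.trace_eq_matrix_trace ℂ (Matrix.stdBasis ℂ (Fin d) (Fin d)), Matrix.trace,
    Fintype.sum_prod_type]
  refine Finset.sum_congr rfl fun i _ => Finset.sum_congr rfl fun j _ => ?_
  rw [Matrix.diag, LinearMap.toMatrix_apply, Matrix.stdBasis_eq_single]
  rfl

lemma unitTrace_conjSuperop {U : Matrix (Fin d) (Fin d) ℂ} (hU : U.conjTranspose * U = 1)
    (N : Superop (Fin d) (Fin d)) : unitTrace (conjSuperop U N) = unitTrace N := by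
  rw [unitTrace, conjSuperop_apply, Matrix.mul_one, hU, Matrix.trace_mul_comm, ← Matrix.mul_assoc,
    hU, Matrix.one_mul, unitTrace]

lemma entTrace_conjSuperop {U : Matrix (Fin d) (Fin d) ℂ} (hU : U.conjTranspose * U = 1)
    (N : Superop (Fin d) (Fin d)) : entTrace (conjSuperop U N) = entTrace N := by
  have h : krausMap U.conjTranspose ∘ₗ krausMap U = LinearMap.id := by
    ext1 σ
    rw [LinearMap.comp_apply, krausMap_apply, krausMap_apply, Matrix.conjTranspose_conjTranspose,
      show U.conjTranspose * (U * σ * U.conjTranspose) * U =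
        (U.conjTranspose * U) * σ * (U.conjTranspose * U) by simp only [Matrix.mul_assoc], hU,
      Matrix.one_mul, Matrix.mul_one, LinearMap.id_apply]
  rw [entTrace_eq_trace, entTrace_eq_trace, conjSuperop, LinearMap.trace_comp_comm',
    LinearMap.comp_assoc, h, LinearMap.comp_id]

/-- The monomial unitary `|k⟩ ↦ ω^{x(k)} |π⁻¹ k⟩` of a pair `g = (x, π)`, with `ω` a primitive cube
root of unity. The inverse keeps the conjugation formulas free of inverses. -/
def monomial (g : (Fin d → ZMod 3) × Equiv.Perm (Fin d)) : Matrix (Fin d) (Fin d) ℂ :=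
  Matrix.of fun j k => if g.2 j = k then ZMod.stdAddChar (g.1 k) else 0

lemma star_stdAddChar (t : ZMod 3) :
    star (ZMod.stdAddChar t : ℂ) = ZMod.stdAddChar (-t) :=
  (AddChar.map_neg_eq_conj _ _).symm

lemma monomial_conj_apply (g : (Fin d → ZMod 3) × Equiv.Perm (Fin d))
    (M : Matrix (Fin d) (Fin d) ℂ) (k l : Fin d) :
    (monomial g * M * (monomial g).conjTranspose) k l =
      ZMod.stdAddChar (g.1 (g.2 k) - g.1 (g.2 l)) * M (g.2 k) (g.2 l) := by
  have h : ∀ k l, (monomial g * M) k l = ZMod.stdAddChar (g.1 (g.2 k)) * M (g.2 k) l :=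
    fun k l => by simp [Matrix.mul_apply, monomial]
  have h' : ∀ p, (monomial g).conjTranspose p l =
      if g.2 l = p then (ZMod.stdAddChar (-g.1 p) : ℂ) else 0 := fun p => by
    simp only [Matrix.conjTranspose_apply, monomial, Matrix.of_apply, apply_ite star, star_zero,
      star_stdAddChar]
  rw [Matrix.mul_apply]
  simp only [h, h', mul_ite, mul_zero, Finset.sum_ite_eq, Finset.mem_univ, if_true]
  rw [sub_eq_add_neg, AddChar.map_add_eq_mul]
  ring

lemma monomial_unitary (g : (Fin d → ZMod 3) × Equiv.Perm (Fin d)) :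
    (monomial g).conjTranspose * monomial g = 1 := by
  rw [mul_eq_one_comm]
  have h : monomial g * (monomial g).conjTranspose = monomial g * 1 * (monomial g).conjTranspose :=
    by rw [Matrix.mul_one]
  rw [h]
  ext k l
  rw [monomial_conj_apply, Matrix.one_apply, Matrix.one_apply]
  by_cases hkl : k = l
  · simp [hkl]
  · simp [hkl]

lemma monomial_conj_single (g : (Fin d → ZMod 3) × Equiv.Perm (Fin d)) (i j : Fin d) :
    (monomial g).conjTranspose * Matrix.single i j 1 * monomial g =
      (ZMod.stdAddChar (g.1 (g.2 j) - g.1 (g.2 i)) : ℂ) • Matrix.single (g.2 i) (g.2 j) 1 := by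
  have hU := monomial_unitary g
  have hU' := mul_eq_one_comm.mp hU
  have key : monomial g * ((ZMod.stdAddChar (g.1 (g.2 j) - g.1 (g.2 i)) : ℂ) •
      Matrix.single (g.2 i) (g.2 j) 1) * (monomial g).conjTranspose = Matrix.single i j 1 := by
    ext k l
    rw [monomial_conj_apply, Matrix.smul_apply, Matrix.single_apply, Matrix.single_apply]
    simp only [EmbeddingLike.apply_eq_iff_eq, smul_eq_mul]
    split_ifs with h
    · obtain ⟨rfl, rfl⟩ := h
      rw [mul_one, ← AddChar.map_add_eq_mul]
      simp
    · simp
  rw [← key]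
  simp only [Matrix.mul_assoc, hU, Matrix.mul_one]
  rw [← Matrix.mul_assoc, hU, Matrix.one_mul]

lemma conjSuperop_monomial_single (g : (Fin d → ZMod 3) × Equiv.Perm (Fin d))
    (N : Superop (Fin d) (Fin d)) (i j k l : Fin d) :
    conjSuperop (monomial g) N (Matrix.single i j 1) k l =
      ZMod.stdAddChar (g.1 (g.2 k) - g.1 (g.2 l) + (g.1 (g.2 j) - g.1 (g.2 i))) *
        N (Matrix.single (g.2 i) (g.2 j) 1) (g.2 k) (g.2 l) := by
  rw [conjSuperop_apply, monomial_conj_single, monomial_conj_apply, map_smul, Matrix.smul_apply,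
    smul_eq_mul, AddChar.map_add_eq_mul, mul_assoc]

/-- The average over the monomial unitaries. -/
def monomialTwirl (N : Superop (Fin d) (Fin d)) : Superop (Fin d) (Fin d) :=
  ∑ g : (Fin d → ZMod 3) × Equiv.Perm (Fin d),
    (((Fintype.card ((Fin d → ZMod 3) × Equiv.Perm (Fin d)) : ℝ)⁻¹ : ℝ) : ℂ) •
      conjSuperop (monomial g) N

lemma sum_card_inv {ι : Type*} [Fintype ι] [Nonempty ι] :
    ∑ _i : ι, ((Fintype.card ι : ℝ)⁻¹) = 1 := by
  rw [Finset.sum_const, Finset.card_univ, nsmul_eq_mul, mul_inv_cancel₀]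
  exact_mod_cast Fintype.card_ne_zero

/-- Functionals invariant under monomial conjugation are invariant under the twirl. -/
lemma monomialTwirl_invariant (F : Superop (Fin d) (Fin d) → ℂ)
    (hadd : ∀ N M, F (N + M) = F N + F M) (hsmul : ∀ (c : ℂ) N, F (c • N) = c * F N)
    (hF : ∀ g N, F (conjSuperop (monomial g) N) = F N) (N : Superop (Fin d) (Fin d)) :
    F (monomialTwirl N) = F N := by
  change AddMonoidHom.mk' F hadd _ = _
  rw [monomialTwirl, map_sum]
  simp only [AddMonoidHom.mk'_apply, hsmul, hF, ← Finset.sum_mul]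
  rw [← Complex.ofReal_sum, sum_card_inv, Complex.ofReal_one, one_mul]

lemma unitTrace_monomialTwirl (N : Superop (Fin d) (Fin d)) :
    unitTrace (monomialTwirl N) = unitTrace N :=
  monomialTwirl_invariant unitTrace (fun N M => by simp [unitTrace])
    (fun c N => by simp [unitTrace]) (fun g N => unitTrace_conjSuperop (monomial_unitary g) N) N

lemma entTrace_monomialTwirl (N : Superop (Fin d) (Fin d)) :
    entTrace (monomialTwirl N) = entTrace N :=
  monomialTwirl_invariant entTrace (fun N M => by simp [entTrace, Finset.sum_add_distrib])
    (fun c N => by simp [entTrace, Finset.mul_sum])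
    (fun g N => entTrace_conjSuperop (monomial_unitary g) N) N

lemma diagTrace_monomialTwirl (N : Superop (Fin d) (Fin d)) :
    diagTrace (monomialTwirl N) = diagTrace N := by
  refine monomialTwirl_invariant diagTrace (fun N M => by simp [diagTrace, Finset.sum_add_distrib])
    (fun c N => by simp [diagTrace, Finset.mul_sum]) (fun g N => ?_) N
  simp only [diagTrace, conjSuperop_monomial_single, sub_self, add_zero, AddChar.map_zero_eq_one,
    one_mul]
  exact Equiv.sum_comp g.2 fun i => N (Matrix.single i i 1) i i

/-- Averaging over cube-root phases kills every coefficient whose indices do not pair up. -/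
lemma sum_stdAddChar_eq_zero {i j k l : Fin d} (h : ¬ ((k = l ∧ i = j) ∨ (k = i ∧ l = j))) :
    ∑ x : Fin d → ZMod 3, (ZMod.stdAddChar (x k - x l + (x j - x i)) : ℂ) = 0 := by
  -- A shift along a basis vector multiplies the sum by a nontrivial character value.
  obtain ⟨v, hv⟩ : ∃ v : Fin d → ZMod 3, v k - v l + (v j - v i) ≠ 0 := by
    by_cases h1 : k = l
    · subst h1
      have hij : i ≠ j := fun e => h (Or.inl ⟨rfl, e⟩)
      exact ⟨Pi.single j 1, by simp [Pi.single_apply, hij]⟩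
    · by_cases h2 : k = i
      · subst h2
        have hlj : l ≠ j := fun e => h (Or.inr ⟨rfl, e⟩)
        exact ⟨Pi.single j 1, by simp [Pi.single_apply, hlj]⟩
      · refine ⟨Pi.single k 1, ?_⟩
        simp only [Pi.single_apply, if_true, Ne.symm h1, Ne.symm h2, if_false]
        split_ifs <;> decide
  have hne : (ZMod.stdAddChar (v k - v l + (v j - v i)) : ℂ) ≠ 1 := fun e =>
    hv (ZMod.injective_stdAddChar (e.trans (AddChar.map_zero_eq_one _).symm))
  have key := Equiv.sum_comp (Equiv.addLeft v)
    fun x : Fin d → ZMod 3 => (ZMod.stdAddChar (x k - x l + (x j - x i)) : ℂ)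
  have hsplit : ∀ x : Fin d → ZMod 3,
      (ZMod.stdAddChar ((v + x) k - (v + x) l + ((v + x) j - (v + x) i)) : ℂ) =
      ZMod.stdAddChar (v k - v l + (v j - v i)) * ZMod.stdAddChar (x k - x l + (x j - x i)) :=
    fun x => by
      rw [← AddChar.map_add_eq_mul]
      congr 1
      simp only [Pi.add_apply]
      ring
  simp only [Equiv.coe_addLeft, hsplit, ← Finset.mul_sum] at key
  by_contra hS
  exact hne (mul_right_cancel₀ hS (key.trans (one_mul _).symm))

lemma monomialTwirl_single (N : Superop (Fin d) (Fin d)) (i j k l : Fin d) :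
    monomialTwirl N (Matrix.single i j 1) k l =
      ∑ g : (Fin d → ZMod 3) × Equiv.Perm (Fin d),
        (((Fintype.card ((Fin d → ZMod 3) × Equiv.Perm (Fin d)) : ℝ)⁻¹ : ℝ) : ℂ) *
        (ZMod.stdAddChar (g.1 (g.2 k) - g.1 (g.2 l) + (g.1 (g.2 j) - g.1 (g.2 i))) *
          N (Matrix.single (g.2 i) (g.2 j) 1) (g.2 k) (g.2 l)) := by
  rw [monomialTwirl, LinearMap.sum_apply, Matrix.sum_apply]
  simp only [LinearMap.smul_apply, Matrix.smul_apply, smul_eq_mul, conjSuperop_monomial_single]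

lemma monomialTwirl_single_eq_zero (N : Superop (Fin d) (Fin d)) {i j k l : Fin d}
    (h : ¬ ((k = l ∧ i = j) ∨ (k = i ∧ l = j))) :
    monomialTwirl N (Matrix.single i j 1) k l = 0 := by
  rw [monomialTwirl_single, Fintype.sum_prod_type_right]
  refine Finset.sum_eq_zero fun π _ => ?_
  dsimp only
  rw [← Finset.mul_sum, ← Finset.sum_mul, sum_stdAddChar_eq_zero, zero_mul, mul_zero]
  simpa only [EmbeddingLike.apply_eq_iff_eq] using h

lemma monomialTwirl_single_perm (N : Superop (Fin d) (Fin d)) (π : Equiv.Perm (Fin d))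
    (i j k l : Fin d) :
    monomialTwirl N (Matrix.single (π i) (π j) 1) (π k) (π l) =
      monomialTwirl N (Matrix.single i j 1) k l := by
  rw [monomialTwirl_single, monomialTwirl_single]
  exact ((Equiv.refl (Fin d → ZMod 3)).prodCongr (Equiv.mulRight π)).sum_comp
    fun g : (Fin d → ZMod 3) × Equiv.Perm (Fin d) =>
        (((Fintype.card ((Fin d → ZMod 3) × Equiv.Perm (Fin d)) : ℝ)⁻¹ : ℝ) : ℂ) *
        (ZMod.stdAddChar (g.1 (g.2 k) - g.1 (g.2 l) + (g.1 (g.2 j) - g.1 (g.2 i))) *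
          N (Matrix.single (g.2 i) (g.2 j) 1) (g.2 k) (g.2 l))

lemma exists_perm_pair {i j k l : Fin d} (hij : i ≠ j) (hkl : k ≠ l) :
    ∃ π : Equiv.Perm (Fin d), π i = k ∧ π j = l := by
  refine ⟨Equiv.swap (Equiv.swap i k j) l * Equiv.swap i k, ?_, ?_⟩
  · rw [Equiv.Perm.mul_apply, Equiv.swap_apply_left, Equiv.swap_apply_of_ne_of_ne _ hkl]
    intro h
    exact hij ((Equiv.swap i k).injective ((Equiv.swap_apply_left i k).trans h))
  · rw [Equiv.Perm.mul_apply, Equiv.swap_apply_left]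

/-- The map `σ ↦ α σ + β Tr[σ] 1 + γ Δ(σ)`, with `Δ` the projection onto the diagonal. -/
def triMap (d : ℕ) (α β γ : ℂ) : Superop (Fin d) (Fin d) where
  toFun σ := α • σ + (β * σ.trace) • (1 : Matrix (Fin d) (Fin d) ℂ) +
    γ • Matrix.diagonal σ.diag
  map_add' X Y := by
    have h : Matrix.diagonal (X + Y).diag = Matrix.diagonal X.diag + Matrix.diagonal Y.diag := by
      rw [Matrix.diag_add, Matrix.diagonal_add]
      rfl
    rw [Matrix.trace_add, h]
    module
  map_smul' c X := by
    rw [Matrix.trace_smul, Matrix.diag_smul, Matrix.diagonal_smul, RingHom.id_apply, smul_eq_mul]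
    module

lemma triMap_apply (α β γ : ℂ) (σ : Matrix (Fin d) (Fin d) ℂ) :
    triMap d α β γ σ = α • σ + (β * σ.trace) • (1 : Matrix (Fin d) (Fin d) ℂ) +
      γ • Matrix.diagonal σ.diag := rfl

lemma triMap_single (α β γ : ℂ) (i j k l : Fin d) :
    triMap d α β γ (Matrix.single i j 1) k l = (if i = k ∧ j = l then α else 0) +
      (if i = j ∧ k = l then β else 0) + if k = l ∧ i = k ∧ j = k then γ else 0 := by
  rw [triMap_apply]
  simp only [Matrix.add_apply, Matrix.smul_apply, Matrix.single_apply, Matrix.trace,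
    Matrix.diag_apply, Matrix.one_apply, Matrix.diagonal_apply, smul_eq_mul]
  have : ∑ x : Fin d, (if i = x ∧ j = x then (1 : ℂ) else 0) = if i = j then 1 else 0 := by
    simp only [ite_and, Finset.sum_ite_eq, Finset.mem_univ, if_true, eq_comm]
  rw [this]
  by_cases h1 : i = j <;> by_cases h2 : k = l <;> simp [ite_and, h1, h2]

/-- A monomially twirled map has the three-parameter form `triMap`. -/
lemma exists_monomialTwirl_eq (hd : 2 ≤ d) (N : Superop (Fin d) (Fin d)) :
    ∃ α β γ, monomialTwirl N = triMap d α β γ := by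
  set T := monomialTwirl N with hT
  let e : Fin d := ⟨0, by omega⟩
  let f : Fin d := ⟨1, by omega⟩
  have hef : e ≠ f := by simp [e, f, Fin.ext_iff]
  refine ⟨T (Matrix.single e f 1) e f, T (Matrix.single e e 1) f f,
    T (Matrix.single e e 1) e e - T (Matrix.single e f 1) e f - T (Matrix.single e e 1) f f, ?_⟩
  refine Matrix.ext_linearMap _ fun i j => LinearMap.ext_ring (Matrix.ext fun k l => ?_)
  change T (Matrix.single i j 1) k l = triMap d _ _ _ (Matrix.single i j 1) k l
  rw [triMap_single]
  by_cases hp : (k = l ∧ i = j) ∨ (k = i ∧ l = j)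
  · rcases hp with ⟨rfl, rfl⟩ | ⟨rfl, rfl⟩
    · by_cases hik : i = k
      · subst hik
        simp only [and_self, if_true]
        have := monomialTwirl_single_perm N (Equiv.swap e i) e e e e
        rw [Equiv.swap_apply_left] at this
        rw [hT, this]
        ring
      · obtain ⟨π, h1, h2⟩ := exists_perm_pair hef hik
        have := monomialTwirl_single_perm N π e e f f
        rw [h1, h2] at this
        simp [hik, hT, this]
    · by_cases hkl : k = l
      · subst hkl
        simp only [and_self, if_true]
        have := monomialTwirl_single_perm N (Equiv.swap e k) e e e e
        rw [Equiv.swap_apply_left] at this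
        rw [hT, this]
        ring
      · obtain ⟨π, h1, h2⟩ := exists_perm_pair hef hkl
        have := monomialTwirl_single_perm N π e f e f
        rw [h1, h2] at this
        simp [hkl, hT, this]
  · rw [hT, monomialTwirl_single_eq_zero N hp, if_neg, if_neg, if_neg]
    · simp
    · rintro ⟨rfl, rfl, rfl⟩; exact hp (Or.inl ⟨rfl, rfl⟩)
    · rintro ⟨rfl, rfl⟩; exact hp (Or.inl ⟨rfl, rfl⟩)
    · rintro ⟨rfl, rfl⟩; exact hp (Or.inr ⟨rfl, rfl⟩)

lemma smul_triMap_add_smul_triMap (s t α β γ α' β' γ' : ℂ) :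
    s • triMap d α β γ + t • triMap d α' β' γ' =
      triMap d (s * α + t * α') (s * β + t * β') (s * γ + t * γ') := by
  ext1 σ
  simp only [LinearMap.add_apply, LinearMap.smul_apply, triMap_apply]
  module

lemma unitTrace_triMap (α β γ : ℂ) :
    unitTrace (triMap d α β γ) = α * d + β * d ^ 2 + γ * d := by
  rw [unitTrace, triMap_apply]
  simp [Matrix.trace_add, Matrix.trace_smul]
  ring

lemma entTrace_triMap (α β γ : ℂ) :
    entTrace (triMap d α β γ) = α * d ^ 2 + β * d + γ * d := by
  simp only [entTrace, triMap_single, and_self, if_true, Finset.sum_add_distrib]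
  simp [ite_and]
  ring

lemma diagTrace_triMap (α β γ : ℂ) :
    diagTrace (triMap d α β γ) = α * d + β * d + γ * d := by
  simp only [diagTrace, triMap_single, and_self, if_true, Finset.sum_add_distrib]
  simp
  ring

/-- Conjugating by the Fourier transform spreads the diagonal projection out: every overlap
`|⟨i|F|k⟩|²` equals `1 / d`. -/
lemma diagTrace_conj_fourier_triMap (hd : 0 < d) (α β γ : ℂ) :
    diagTrace (conjSuperop (fourier d) (triMap d α β γ)) = α * d + β * d + γ := by
  have hU' := fourier_mul_conjTranspose hd
  have hU := mul_eq_one_comm.mp hU'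
  have hd' : (d : ℂ) ≠ 0 := by exact_mod_cast hd.ne'
  have h : ∀ i : Fin d, conjSuperop (fourier d) (triMap d α β γ) (Matrix.single i i 1) i i =
      α + β + γ * (d : ℂ)⁻¹ := by
    intro i
    rw [conjSuperop_apply, triMap_apply]
    set F := fourier d with hF
    set P := F.conjTranspose * Matrix.single i i 1 * F with hP
    have h1 : F * P * F.conjTranspose = Matrix.single i i 1 := by
      rw [hP, show F * (F.conjTranspose * Matrix.single i i 1 * F) * F.conjTranspose =
        (F * F.conjTranspose) * Matrix.single i i 1 * (F * F.conjTranspose) by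
          simp only [Matrix.mul_assoc], hU', Matrix.one_mul, Matrix.mul_one]
    have h2 : P.trace = 1 := by
      rw [hP, Matrix.trace_mul_comm, ← Matrix.mul_assoc, hU', Matrix.one_mul,
        Matrix.trace_single_eq_same]
    have h3 : ∀ k, P k k = (d : ℂ)⁻¹ := fun k => by
      rw [← fourier_mul_star i k, hP]
      simp [Matrix.mul_apply, Matrix.single_apply, ite_and, mul_comm, hF]
    have h4 : Matrix.diagonal P.diag = (d : ℂ)⁻¹ • (1 : Matrix (Fin d) (Fin d) ℂ) := by
      rw [← Matrix.diagonal_one, ← Matrix.diagonal_smul]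
      congr 1
      ext k
      simp [h3]
    rw [h4, h2, Matrix.mul_add, Matrix.mul_add, Matrix.add_mul, Matrix.add_mul, Matrix.mul_smul,
      Matrix.smul_mul, h1, Matrix.mul_smul, Matrix.smul_mul, Matrix.mul_smul, Matrix.mul_smul,
      Matrix.smul_mul, Matrix.smul_mul, Matrix.mul_one, hU']
    simp
  rw [diagTrace, Finset.sum_congr rfl fun i _ => h i, Finset.sum_const, Finset.card_univ,
    Fintype.card_fin, nsmul_eq_mul]
  field_simp

/-- The twirl onto isotropic maps. The monomial average leaves the projection `Δ` onto the diagonal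
with some coefficient `γ`; Fourier conjugation followed by the monomial average multiplies that
coefficient by `-1/d`, so that the weights `1 : d` cancel it. -/
def isotropicTwirl (N : Superop (Fin d) (Fin d)) : Superop (Fin d) (Fin d) :=
  (((1 / (d + 1) : ℝ)) : ℂ) • monomialTwirl N +
    (((d / (d + 1) : ℝ)) : ℂ) • monomialTwirl (conjSuperop (fourier d) (monomialTwirl N))

/-- The isotropic twirl keeps `unitTrace` and `entTrace`, and has no diagonal component. These two
functionals determine the two remaining parameters. -/
lemma exists_isotropicTwirl_eq (hd : 2 ≤ d) (N : Superop (Fin d) (Fin d)) :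
    ∃ α β : ℂ, isotropicTwirl N = triMap d α β 0 ∧ α * d + β * d ^ 2 = unitTrace N ∧
      α * d ^ 2 + β * d = entTrace N := by
  have hd0 : 0 < d := by omega
  have hU := mul_eq_one_comm.mp (fourier_mul_conjTranspose hd0)
  obtain ⟨α, β, γ, h₁⟩ := exists_monomialTwirl_eq hd N
  obtain ⟨α', β', γ', h₂⟩ := exists_monomialTwirl_eq hd (conjSuperop (fourier d) (monomialTwirl N))
  have t₁ := unitTrace_monomialTwirl N
  have t₂ := unitTrace_monomialTwirl (conjSuperop (fourier d) (monomialTwirl N))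
  have e₁ := entTrace_monomialTwirl N
  have e₂ := entTrace_monomialTwirl (conjSuperop (fourier d) (monomialTwirl N))
  have δ₂ := diagTrace_monomialTwirl (conjSuperop (fourier d) (monomialTwirl N))
  rw [unitTrace_conjSuperop hU, t₁, h₂, unitTrace_triMap] at t₂
  rw [entTrace_conjSuperop hU, e₁, h₂, entTrace_triMap] at e₂
  rw [h₂, h₁, diagTrace_conj_fourier_triMap hd0, diagTrace_triMap] at δ₂
  rw [h₁, unitTrace_triMap] at t₁
  rw [h₁, entTrace_triMap] at e₁
  have hd' : (d : ℂ) ≠ 0 := by exact_mod_cast hd0.ne'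
  have hd1 : (d : ℂ) + 1 ≠ 0 := by exact_mod_cast (Nat.succ_ne_zero d)
  have hdm : (d : ℂ) - 1 ≠ 0 := by
    rw [sub_ne_zero]; exact_mod_cast (by omega : d ≠ 1)
  -- The three invariants force `γ' = -γ / d`.
  have hγ : γ + d * γ' = 0 := by
    refine (mul_eq_zero.mp ?_).resolve_left hdm
    linear_combination (1 + (d : ℂ)) * δ₂ - (t₂ - t₁) - (e₂ - e₁)
  have hw : (((1 / (d + 1) : ℝ)) : ℂ) + (((d / (d + 1) : ℝ)) : ℂ) = 1 := by
    push_cast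
    field_simp
    ring
  have h0 : (((1 / (d + 1) : ℝ)) : ℂ) * γ + (((d / (d + 1) : ℝ)) : ℂ) * γ' = 0 := by
    push_cast
    field_simp
    simpa using hγ
  refine ⟨(((1 / (d + 1) : ℝ)) : ℂ) * α + (((d / (d + 1) : ℝ)) : ℂ) * α',
    (((1 / (d + 1) : ℝ)) : ℂ) * β + (((d / (d + 1) : ℝ)) : ℂ) * β', ?_, ?_, ?_⟩
  · rw [isotropicTwirl, h₂, h₁, smul_triMap_add_smul_triMap, h0]
  · linear_combination (((1 / (d + 1) : ℝ)) : ℂ) * t₁ + (((d / (d + 1) : ℝ)) : ℂ) * t₂ +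
      unitTrace N * hw - d * h0
  · linear_combination (((1 / (d + 1) : ℝ)) : ℂ) * e₁ + (((d / (d + 1) : ℝ)) : ℂ) * e₂ +
      entTrace N * hw - d * h0

end Twirl

/-! ### Twirling one-way LOCC maps -/

section TwirlOneWay

variable {d : ℕ} {a b : Type*} [Fintype a] [DecidableEq a] [Fintype b] [DecidableEq b]

lemma exists_isOneWayLOCC_monomialTwirl {𝓛 : Superop (Fin d × (a × b)) (Fin d)}
    (h𝓛 : IsOneWayLOCC 𝓛) : ∃ 𝓜 : Superop (Fin d × (a × b)) (Fin d), IsOneWayLOCC 𝓜 ∧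
      ∀ τ, simChannel 𝓜 τ = monomialTwirl (simChannel 𝓛 τ) := by
  refine ⟨_, IsOneWayLOCC.sum_smul
    (fun g : (Fin d → ZMod 3) × Equiv.Perm (Fin d) => h𝓛.conjMap (monomial_unitary g))
    (fun _ => by positivity) sum_card_inv, fun τ => ?_⟩
  have h := fun g : (Fin d → ZMod 3) × Equiv.Perm (Fin d) => simChannel_conjMap (monomial g) 𝓛 τ
  ext1 σ
  rw [monomialTwirl, simChannel_apply, LinearMap.sum_apply, LinearMap.sum_apply]
  refine Finset.sum_congr rfl fun g _ => ?_
  rw [LinearMap.smul_apply, LinearMap.smul_apply, ← simChannel_apply, h, conjSuperop]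

/-- The isotropic twirl uses finitely many unitaries, so it can be carried out by a one-way LOCC
protocol with finitely many messages. -/
lemma exists_isOneWayLOCC_isotropicTwirl (hd : 2 ≤ d) {𝓛 : Superop (Fin d × (a × b)) (Fin d)}
    (h𝓛 : IsOneWayLOCC 𝓛) : ∃ 𝓜 : Superop (Fin d × (a × b)) (Fin d), IsOneWayLOCC 𝓜 ∧
      ∀ τ, simChannel 𝓜 τ = isotropicTwirl (simChannel 𝓛 τ) := by
  have hU := mul_eq_one_comm.mp (fourier_mul_conjTranspose (d := d) (by omega))
  obtain ⟨𝓜, h𝓜, h₁⟩ := exists_isOneWayLOCC_monomialTwirl h𝓛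
  obtain ⟨𝓜', h𝓜', h₂⟩ := exists_isOneWayLOCC_monomialTwirl (h𝓜.conjMap hU)
  refine ⟨_, h𝓜.add_smul h𝓜' (s := 1 / (d + 1)) (t := d / (d + 1)) (by positivity) (by positivity)
    (by field_simp; ring), fun τ => ?_⟩
  rw [isotropicTwirl, ← h₁, conjSuperop, ← simChannel_conjMap, ← h₂]
  rfl

/-- If `K` represents the entanglement functional of the one-way LOCC map `𝓛`, then twirling turns
`𝓛` into the covariant map of `K` and `1 - K`. -/
lemma IsOneWayLOCC.covariantMap (hd : 2 ≤ d) {𝓛 : Superop (Fin d × (a × b)) (Fin d)}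
    (h𝓛 : IsOneWayLOCC 𝓛) {K L : Matrix (a × b) (a × b) ℂ} (hKL : K + L = 1)
    (hK : ∀ τ, (d : ℂ) ^ 2 * (K * τ).trace = entTrace (simChannel 𝓛 τ)) :
    IsOneWayLOCC (covariantMap d K L) := by
  obtain ⟨𝓜, h𝓜, h⟩ := exists_isOneWayLOCC_isotropicTwirl hd h𝓛
  convert h𝓜 using 1
  refine ext_simChannel fun τ => ?_
  obtain ⟨α, β, h₁, h₂, h₃⟩ := exists_isotropicTwirl_eq hd (simChannel 𝓛 τ)
  have ht : unitTrace (simChannel 𝓛 τ) = d * τ.trace := by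
    rw [unitTrace, simChannel_apply, h𝓛.isChannel.2, Matrix.trace_kronecker, Matrix.trace_one,
      Fintype.card_fin]
  have hL : (L * τ).trace = τ.trace - (K * τ).trace := by
    rw [eq_sub_iff_add_eq', ← Matrix.trace_add, ← Matrix.add_mul, hKL, Matrix.one_mul]
  have hd0 : 0 < d := by omega
  have hd' : (d : ℂ) ≠ 0 := by exact_mod_cast hd0.ne'
  have hdm : (d : ℂ) ^ 2 - 1 ≠ 0 := by
    rw [sub_ne_zero]
    have : d ^ 2 ≠ 1 := by nlinarith
    exact_mod_cast this
  rw [ht] at h₂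
  rw [← hK] at h₃
  have h₂' : α + β * d = τ.trace := mul_left_cancel₀ hd' (by linear_combination h₂)
  have h₃' : α * d + β = d * (K * τ).trace := mul_left_cancel₀ hd' (by linear_combination h₃)
  have hα : α = (K * τ).trace - (τ.trace - (K * τ).trace) / ((d : ℂ) ^ 2 - 1) := by
    field_simp
    linear_combination (d : ℂ) * h₃' - h₂'
  have hβ : β = (d : ℂ) * (τ.trace - (K * τ).trace) / ((d : ℂ) ^ 2 - 1) := by
    field_simp
    linear_combination (d : ℂ) * h₂' - h₃'
  rw [h, h₁, simChannel_covariantMap, hL]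
  ext1 σ
  rw [LinearMap.add_apply, LinearMap.smul_apply, LinearMap.smul_apply, randomizing_apply hd0,
    triMap_apply, hα, hβ, LinearMap.id_apply]
  module

end TwirlOneWay

/-! ### Maximally entangled states and the entanglement functional -/

section MaxEnt

variable {d : ℕ}

/-- The maximally entangled unit vector `d^{-1/2} ∑_i |i⟩|i⟩`. -/
def maxEnt (d : ℕ) : Fin d × Fin d → ℂ :=
  fun u => if u.1 = u.2 then (((√(d : ℝ))⁻¹ : ℝ) : ℂ) else 0

lemma star_maxEnt : star (maxEnt d) = maxEnt d := by
  ext u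
  simp only [maxEnt, Pi.star_apply, apply_ite star, star_zero, Complex.star_def,
    Complex.conj_ofReal]

lemma maxEnt_unit (hd : 0 < d) : star (maxEnt d) ⬝ᵥ maxEnt d = 1 := by
  have hd' : (d : ℂ) ≠ 0 := by exact_mod_cast hd.ne'
  rw [star_maxEnt, dotProduct, Fintype.sum_prod_type]
  simp only [maxEnt, mul_ite, mul_zero, ite_mul, zero_mul, sqrt_inv_mul_self]
  simp [hd']

lemma isState_maxEnt (hd : 0 < d) : IsState (Matrix.vecMulVec (maxEnt d) (star (maxEnt d))) :=
  ⟨Matrix.posSemidef_vecMulVec_self_star _, by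
    rw [Matrix.trace_vecMulVec, dotProduct_comm, maxEnt_unit hd]⟩

lemma amplify_maxEnt (N : Superop (Fin d) (Fin d)) (u v : Fin d × Fin d) :
    amplify d N (Matrix.vecMulVec (maxEnt d) (star (maxEnt d))) u v =
      (d : ℂ)⁻¹ * N (Matrix.single u.1 v.1 1) u.2 v.2 := by
  have h : (Matrix.of fun i j =>
      Matrix.vecMulVec (maxEnt d) (star (maxEnt d)) (u.1, i) (v.1, j)) =
      (d : ℂ)⁻¹ • Matrix.single u.1 v.1 (1 : ℂ) := by
    ext i j
    rw [star_maxEnt, ← sqrt_inv_mul_self]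
    by_cases h₁ : u.1 = i <;> by_cases h₂ : v.1 = j <;>
      simp [Matrix.vecMulVec_apply, maxEnt, h₁, h₂]
  rw [amplify_apply, h, map_smul, Matrix.smul_apply, smul_eq_mul]

/-- The entanglement fidelity of `N` is the entanglement functional divided by `d²`. -/
lemma maxEnt_overlap (N : Superop (Fin d) (Fin d)) :
    star (maxEnt d) ⬝ᵥ (amplify d N (Matrix.vecMulVec (maxEnt d) (star (maxEnt d)))).mulVec
      (maxEnt d) = entTrace N / (d : ℂ) ^ 2 := by
  rw [star_maxEnt, dotProduct, entTrace, Finset.sum_div, Fintype.sum_prod_type]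
  refine Finset.sum_congr rfl fun i _ => ?_
  have h : ∀ v, amplify d N (Matrix.vecMulVec (maxEnt d) (maxEnt d)) (i, i) v =
      (d : ℂ)⁻¹ * N (Matrix.single i v.1 1) i v.2 := fun v => by
    have := amplify_maxEnt N (i, i) v
    rwa [star_maxEnt] at this
  have h0 : ∀ j, maxEnt d (i, j) = if i = j then (((√(d : ℝ))⁻¹ : ℝ) : ℂ) else 0 := fun j => rfl
  simp only [h0, ite_mul, zero_mul, Finset.sum_ite_eq, Finset.mem_univ, if_true, Matrix.mulVec,
    dotProduct, h, Fintype.sum_prod_type]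
  simp only [maxEnt, mul_ite, mul_zero, Finset.sum_ite_eq, Finset.mem_univ, if_true,
    Finset.mul_sum, Finset.sum_div]
  refine Finset.sum_congr rfl fun j _ => ?_
  rw [div_eq_mul_inv, pow_two, mul_inv]
  nth_rewrite 3 [← sqrt_inv_mul_self]
  ring

lemma posSemidef_of_forall_nonneg {n : Type*} [Fintype n] [DecidableEq n] {K : Matrix n n ℂ}
    (h : ∀ v, 0 ≤ star v ⬝ᵥ K.mulVec v) : K.PosSemidef := by
  refine Matrix.PosSemidef.of_dotProduct_mulVec_nonneg ?_ h
  rw [← Matrix.isSymmetric_toEuclideanLin_iff, LinearMap.isSymmetric_iff_inner_map_self_real]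
  intro v
  have hv := Complex.conj_eq_iff_im.mpr (Complex.le_def.mp (h v.ofLp)).2.symm
  have hi : inner ℂ (K.toEuclideanLin v) v = star (star v.ofLp ⬝ᵥ K.mulVec v.ofLp) := by
    rw [EuclideanSpace.inner_eq_star_dotProduct, Matrix.star_dotProduct, star_star]
    exact dotProduct_comm _ _
  rw [hi, Complex.star_def, hv, hv]

variable {a b : Type*} [Fintype a] [DecidableEq a] [Fintype b] [DecidableEq b]

/-- The operator on `ÂB̂` representing `τ ↦ d⁻² entTrace (𝓛(· ⊗ τ))`. -/
def overlapOperator (𝓛 : Superop (Fin d × (a × b)) (Fin d)) : Matrix (a × b) (a × b) ℂ :=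
  Matrix.of fun u v => entTrace (simChannel 𝓛 (Matrix.single v u 1)) / (d : ℂ) ^ 2

lemma trace_overlapOperator_mul (𝓛 : Superop (Fin d × (a × b)) (Fin d))
    (τ : Matrix (a × b) (a × b) ℂ) :
    (overlapOperator 𝓛 * τ).trace = entTrace (simChannel 𝓛 τ) / (d : ℂ) ^ 2 := by
  let F : Matrix (a × b) (a × b) ℂ →ₗ[ℂ] ℂ :=
    { toFun := fun τ => entTrace (simChannel 𝓛 τ) / (d : ℂ) ^ 2
      map_add' := fun X Y => by
        simp [entTrace, simChannel_apply, Matrix.kronecker_add, Finset.sum_add_distrib, add_div]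
      map_smul' := fun c X => by
        simp [entTrace, simChannel_apply, Matrix.kronecker_smul, ← Finset.mul_sum, mul_div_assoc] }
  change _ = F τ
  conv_rhs => rw [Matrix.matrix_eq_sum_single τ]
  simp only [map_sum, Matrix.trace, Matrix.diag, Matrix.mul_apply]
  rw [Finset.sum_comm]
  refine Finset.sum_congr rfl fun u _ => Finset.sum_congr rfl fun v _ => ?_
  have h : Matrix.single u v (τ u v) = τ u v • Matrix.single u v (1 : ℂ) := by
    rw [Matrix.smul_single, smul_eq_mul, mul_one]
  rw [h, map_smul, smul_eq_mul, mul_comm]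
  rfl

lemma trace_overlapOperator_mul' (𝓛 : Superop (Fin d × (a × b)) (Fin d))
    (τ : Matrix (a × b) (a × b) ℂ) :
    (overlapOperator 𝓛 * τ).trace = star (maxEnt d) ⬝ᵥ
      (amplify d (simChannel 𝓛 τ) (Matrix.vecMulVec (maxEnt d) (star (maxEnt d)))).mulVec
      (maxEnt d) := by
  rw [trace_overlapOperator_mul, maxEnt_overlap]

lemma trace_mul_vecMulVec {n : Type*} [Fintype n] (K : Matrix n n ℂ) (v : n → ℂ) :
    (K * Matrix.vecMulVec v (star v)).trace = star v ⬝ᵥ K.mulVec v := by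
  rw [Matrix.trace_mul_comm, trace_vecMulVec_mul]

lemma overlapOperator_posSemidef {𝓛 : Superop (Fin d × (a × b)) (Fin d)} (h𝓛 : IsCP 𝓛) :
    (overlapOperator 𝓛).PosSemidef := by
  refine posSemidef_of_forall_nonneg fun v => ?_
  rw [← trace_mul_vecMulVec, trace_overlapOperator_mul']
  have hτ := Matrix.posSemidef_vecMulVec_self_star v
  exact (h𝓛.simChannel hτ d _ (Matrix.posSemidef_vecMulVec_self_star _)).dotProduct_mulVec_nonneg _

/-- `⟨φ|M|φ⟩ ≤ Tr M` for positive `M` and a unit vector `φ`. -/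
lemma dotProduct_mulVec_le_trace {n : Type*} [Fintype n] [DecidableEq n] {M : Matrix n n ℂ}
    (hM : M.PosSemidef) {φ : n → ℂ} (hφ : star φ ⬝ᵥ φ = 1) :
    star φ ⬝ᵥ M.mulVec φ ≤ M.trace := by
  set Φ := Matrix.vecMulVec φ (star φ) with hΦ
  have hΦh : Φ.conjTranspose = Φ := (Matrix.posSemidef_vecMulVec_self_star φ).isHermitian.eq
  have hΦΦ : Φ * Φ = Φ := vecMulVec_self_mul_self hφ
  have h1 : (1 - Φ).PosSemidef := by
    have h : 1 - Φ = (1 - Φ).conjTranspose * (1 - Φ) := by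
      rw [Matrix.conjTranspose_sub, hΦh, Matrix.conjTranspose_one, Matrix.sub_mul, Matrix.mul_sub,
        Matrix.mul_one, Matrix.one_mul, Matrix.mul_sub, hΦΦ]
      simp
    rw [h]
    exact Matrix.posSemidef_conjTranspose_mul_self _
  have h2 := trace_mul_nonneg h1 hM
  rw [Matrix.sub_mul, Matrix.one_mul, Matrix.trace_sub, trace_vecMulVec_mul] at h2
  exact sub_nonneg.mp h2

/-- The complement is positive because `𝓛` preserves the trace and the overlap of a positive
operator with a unit vector is at most its trace. -/
lemma one_sub_overlapOperator_posSemidef (hd : 0 < d) {𝓛 : Superop (Fin d × (a × b)) (Fin d)}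
    (h𝓛 : IsChannel 𝓛) : (1 - overlapOperator 𝓛).PosSemidef := by
  refine posSemidef_of_forall_nonneg fun v => ?_
  have hτ := Matrix.posSemidef_vecMulVec_self_star v
  have hM := h𝓛.1.simChannel hτ d _ (Matrix.posSemidef_vecMulVec_self_star (maxEnt d))
  have h := dotProduct_mulVec_le_trace hM (maxEnt_unit hd)
  rw [← trace_overlapOperator_mul'] at h
  have ht : (amplify d (simChannel 𝓛 (Matrix.vecMulVec v (star v)))
      (Matrix.vecMulVec (maxEnt d) (star (maxEnt d)))).trace = star v ⬝ᵥ v := by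
    have h1 := (isState_maxEnt hd).2
    simp only [Matrix.trace, Matrix.diag, Fintype.sum_prod_type] at h1 ⊢
    have h2 : ∀ i : Fin d, ∑ j, amplify d (simChannel 𝓛 (Matrix.vecMulVec v (star v)))
        (Matrix.vecMulVec (maxEnt d) (star (maxEnt d))) (i, j) (i, j) =
        (∑ j, Matrix.vecMulVec (maxEnt d) (star (maxEnt d)) (i, j) (i, j)) * (star v ⬝ᵥ v) := by
      intro i
      refine (h𝓛.2 ((Matrix.of fun j k =>
        Matrix.vecMulVec (maxEnt d) (star (maxEnt d)) (i, j) (i, k))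
        ⊗ₖ Matrix.vecMulVec v (star v))).trans ?_
      rw [Matrix.trace_kronecker, Matrix.trace_vecMulVec, dotProduct_comm v]
      rfl
    rw [Finset.sum_congr rfl fun i _ => h2 i, ← Finset.sum_mul, h1, one_mul]
  rw [ht, trace_mul_vecMulVec] at h
  rw [Matrix.sub_mulVec, Matrix.one_mulVec, dotProduct_sub]
  exact sub_nonneg.mpr h

end MaxEnt

/-! ### The link product -/

section Link

variable {d : ℕ} {a b : Type*} [Fintype a] [Fintype b] [DecidableEq b]

lemma aliceOutcome_kronecker_single (Λ : Matrix (Fin d × a) (Fin d × a) ℂ)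
    (τ : Matrix (a × b) (a × b) ℂ) (i j : Fin d) (p q : b) :
    aliceOutcome Λ (Matrix.single i j 1 ⊗ₖ τ) p q =
      ∑ s, ∑ s', Λ (j, s) (i, s') * τ (s', p) (s, q) := by
  simp [aliceOutcome_apply, Fintype.sum_prod_type, Matrix.single_apply, ite_and]

variable [DecidableEq a]

lemma superop_apply {n m : Type*} [Fintype n] [DecidableEq n] (N : Superop n m) (X : Matrix n n ℂ)
    (i j : m) : N X i j = ∑ p, ∑ q, X p q * N (Matrix.single p q 1) i j := by
  conv_lhs => rw [Matrix.matrix_eq_sum_single X]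
  simp only [map_sum, Matrix.sum_apply]
  refine Finset.sum_congr rfl fun p _ => Finset.sum_congr rfl fun q _ => ?_
  have h : Matrix.single p q (X p q) = X p q • Matrix.single p q (1 : ℂ) := by
    rw [Matrix.smul_single, smul_eq_mul, mul_one]
  rw [h, map_smul, Matrix.smul_apply, smul_eq_mul]

lemma linkProduct_apply (Λ : Matrix (Fin d × a) (Fin d × a) ℂ)
    (Γ : Matrix (b × Fin d) (b × Fin d) ℂ) (s s' : a) (p q : b) :
    linkProduct Λ Γ (s, p) (s', q) = ∑ i, ∑ j, Λ (j, s) (i, s') * Γ (p, j) (q, i) := by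
  simp [linkProduct, ptraceFst, ptransposeFst, Matrix.mul_apply, Fintype.sum_prod_type,
    Matrix.one_apply, Matrix.kroneckerMap_apply]

lemma sum_rearrange {I P S : Type*} [Fintype I] [Fintype P] [Fintype S]
    (f : I → I → P → P → S → S → ℂ) :
    ∑ i, ∑ j, ∑ p, ∑ q, ∑ s, ∑ s', f i j p q s s' =
      ∑ s, ∑ p, ∑ s', ∑ q, ∑ i, ∑ j, f i j p q s s' := by
  let e : I × I × P × P × S × S ≃ S × P × S × P × I × I :=
    { toFun := fun t => (t.2.2.2.2.1, t.2.2.1, t.2.2.2.2.2, t.2.2.2.1, t.1, t.2.1)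
      invFun := fun t => (t.2.2.2.2.1, t.2.2.2.2.2, t.2.1, t.2.2.2.1, t.1, t.2.2.1)
      left_inv := fun _ => rfl
      right_inv := fun _ => rfl }
  have h := Fintype.sum_equiv e
    (fun t => f t.1 t.2.1 t.2.2.1 t.2.2.2.1 t.2.2.2.2.1 t.2.2.2.2.2)
    (fun t => f t.2.2.2.2.1 t.2.2.2.2.2 t.2.1 t.2.2.2.1 t.1 t.2.2.1) (fun _ => rfl)
  simpa only [Fintype.sum_prod_type] using h

/-- The link product of `Λ` with the Choi operator of `D` represents the entanglement functional of
the protocol in which Bob applies the transposed channel of `D`. -/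
lemma entTrace_link (Λ : Matrix (Fin d × a) (Fin d × a) ℂ) (D : Superop b (Fin d))
    (τ : Matrix (a × b) (a × b) ℂ) :
    entTrace (simChannel (transposeConj D ∘ₗ aliceMap Λ) τ) =
      (linkProduct Λ (choi D) * τ).trace := by
  have h : ∀ i j, simChannel (transposeConj D ∘ₗ aliceMap Λ) τ (Matrix.single i j 1) i j =
      ∑ p, ∑ q, ∑ s, ∑ s', Λ (j, s) (i, s') * τ (s', q) (s, p) * D (Matrix.single p q 1) j i := by
    intro i j
    rw [simChannel_apply, LinearMap.comp_apply, transposeConj_apply, Matrix.transpose_apply,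
      superop_apply]
    simp only [Matrix.transpose_apply, aliceMap_apply, aliceOutcome_kronecker_single,
      Finset.sum_mul]
  simp only [entTrace, h]
  rw [sum_rearrange]
  simp only [Matrix.trace, Matrix.diag, Matrix.mul_apply, Fintype.sum_prod_type, linkProduct_apply,
    Finset.sum_mul, choi, Matrix.of_apply]
  refine Finset.sum_congr rfl fun s _ => Finset.sum_congr rfl fun p _ =>
    Finset.sum_congr rfl fun s' _ => Finset.sum_congr rfl fun q _ =>
    Finset.sum_congr rfl fun i _ => Finset.sum_congr rfl fun j _ => ?_
  ring

lemma entTrace_oneWayMap {ι : Type*} [Fintype ι] (Λ : ι → Matrix (Fin d × a) (Fin d × a) ℂ)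
    (𝒟 : ι → Superop b (Fin d)) (τ : Matrix (a × b) (a × b) ℂ) :
    entTrace (simChannel (oneWayMap Λ fun x => transposeConj (𝒟 x)) τ) =
      ((∑ x, linkProduct (Λ x) (choi (𝒟 x))) * τ).trace := by
  have h : simChannel (oneWayMap Λ fun x => transposeConj (𝒟 x)) τ =
      ∑ x, simChannel (transposeConj (𝒟 x) ∘ₗ aliceMap (Λ x)) τ := by
    ext1 σ
    simp only [simChannel_apply, oneWayMap, LinearMap.sum_apply]
  rw [Finset.sum_mul, Matrix.trace_sum, h, entTrace_eq_trace, map_sum]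
  simp only [← entTrace_eq_trace, entTrace_link]

end Link

/-! ### Bounds on the diamond distance and the channel fidelity -/

section Bounds

variable {n m : Type*} [Fintype n] [Fintype m] [DecidableEq m]

lemma traceNorm_le_diamondDist {N M : Superop n m} (hN : IsChannel N) (hM : IsChannel M) {k : ℕ}
    {ρ : Matrix (Fin k × n) (Fin k × n) ℂ} (hρ : IsState ρ) :
    traceNorm (amplify k N ρ - amplify k M ρ) ≤ diamondDist N M := by
  refine le_csSup ⟨2, ?_⟩ ⟨k, ρ, hρ, rfl⟩
  rintro _ ⟨k, ρ, hρ, rfl⟩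
  have h₁ := hN.isState_amplify k hρ
  have h₂ := hM.isState_amplify k hρ
  refine (traceNorm_sub_le h₁.1 h₂.1).trans_eq ?_
  rw [h₁.2, h₂.2, Complex.one_re]
  norm_num

lemma channelFidelity_le (N M : Superop n m) {k : ℕ} {ρ : Matrix (Fin k × n) (Fin k × n) ℂ}
    (hρ : IsState ρ) : channelFidelity N M ≤ fidelity (amplify k N ρ) (amplify k M ρ) := by
  refine csInf_le ⟨0, ?_⟩ ⟨k, ρ, hρ, rfl⟩
  rintro _ ⟨k, ρ, hρ, rfl⟩
  exact fidelity_nonneg _ _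

variable {d : ℕ}

lemma isChannel_id : IsChannel (LinearMap.id : Superop (Fin d) (Fin d)) :=
  ⟨IsCP.id, fun _ => rfl⟩

/-- A mixture `p id + (1 - p) M` is within normalized diamond distance `1 - p` of the identity. -/
lemma diamondDist_mix_le {M : Superop (Fin d) (Fin d)} (hM : IsChannel M) {p : ℝ} (hp : p ≤ 1) :
    1 / 2 * diamondDist LinearMap.id
      ((p : ℂ) • (LinearMap.id : Superop (Fin d) (Fin d)) + ((1 - p : ℝ) : ℂ) • M) ≤ 1 - p := by
  have h : diamondDist LinearMap.id
      ((p : ℂ) • (LinearMap.id : Superop (Fin d) (Fin d)) + ((1 - p : ℝ) : ℂ) • M) ≤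
      2 * (1 - p) := by
    refine Real.sSup_le ?_ (by linarith)
    rintro _ ⟨k, ρ, hρ, rfl⟩
    have h₂ := hM.isState_amplify k hρ
    have e : amplify k LinearMap.id ρ - amplify k ((p : ℂ) • LinearMap.id +
        ((1 - p : ℝ) : ℂ) • M) ρ = ((1 - p : ℝ) : ℂ) • (ρ - amplify k M ρ) := by
      rw [amplify_add, amplify_smul, amplify_smul, amplify_id]
      push_cast
      module
    rw [e, traceNorm_smul (by linarith)]
    have h₃ := traceNorm_sub_le hρ.1 h₂.1
    rw [hρ.2, h₂.2, Complex.one_re] at h₃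
    nlinarith
  linarith

/-- A mixture `p id + (1 - p) M` has channel fidelity at least `p` with the identity. -/
lemma le_channelFidelity_mix (hd : 0 < d) {M : Superop (Fin d) (Fin d)} (hM : IsChannel M) {p : ℝ}
    (hp0 : 0 ≤ p) (hp : p ≤ 1) :
    p ≤ channelFidelity LinearMap.id
      ((p : ℂ) • (LinearMap.id : Superop (Fin d) (Fin d)) + ((1 - p : ℝ) : ℂ) • M) := by
  refine le_csInf ⟨_, d, _, isState_maxEnt hd, rfl⟩ ?_
  rintro _ ⟨k, ρ, hρ, rfl⟩
  refine le_fidelity hρ hp0 ?_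
  rw [amplify_add, amplify_smul, amplify_smul, amplify_id, add_sub_cancel_left]
  refine (hM.1 k ρ hρ.1).smul ?_
  exact_mod_cast sub_nonneg.mpr hp

/-- The maximally entangled input bounds the diamond distance to the identity from below. -/
lemma one_sub_entTrace_le_diamondDist (hd : 0 < d) {N : Superop (Fin d) (Fin d)}
    (hN : IsChannel N) :
    1 - (entTrace N / (d : ℂ) ^ 2).re ≤ 1 / 2 * diamondDist LinearMap.id N := by
  have hφ := isState_maxEnt hd
  have h₁ := traceNorm_le_diamondDist isChannel_id hN hφ
  have h₂ := le_traceNorm_pure_sub (maxEnt_unit hd) (hN.isState_amplify d hφ).2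
  rw [maxEnt_overlap] at h₂
  rw [amplify_id] at h₁
  linarith

/-- The maximally entangled input bounds the channel fidelity with the identity from above. -/
lemma channelFidelity_le_entTrace (hd : 0 < d) {N : Superop (Fin d) (Fin d)}
    (hN : IsChannel N) :
    channelFidelity LinearMap.id N ≤ (entTrace N / (d : ℂ) ^ 2).re := by
  have hφ := isState_maxEnt hd
  rw [← maxEnt_overlap]
  exact (channelFidelity_le _ _ hφ).trans
    (fidelity_pure_le (maxEnt_unit hd) (hN.1 d _ hφ.1))

end Bounds

/-! ### Simulation errors of one-way LOCC protocols -/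

section Errors

variable {d : ℕ} {a b : Type*} [Fintype a] [Fintype b]

/-- The randomizing channel is invisible to the entanglement functional. -/
lemma entTrace_simChannel_covariantMap (hd : 2 ≤ d) (K L τ : Matrix (a × b) (a × b) ℂ) :
    entTrace (simChannel (covariantMap d K L) τ) = (d : ℂ) ^ 2 * (K * τ).trace := by
  have hid : entTrace (LinearMap.id : Superop (Fin d) (Fin d)) = (d : ℂ) ^ 2 := by
    simp [entTrace, pow_two]
  have hrand : entTrace (randomizing d) = 0 := by
    simp only [entTrace, randomizing_apply (show 0 < d by omega), Matrix.smul_apply,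
      Matrix.sub_apply, Matrix.one_apply, Matrix.trace, Matrix.diag, Matrix.single_apply]
    simp [← Finset.mul_sum, Finset.sum_sub_distrib, ite_and]
  rw [simChannel_covariantMap, entTrace_eq_trace, map_add, map_smul, map_smul,
    ← entTrace_eq_trace, ← entTrace_eq_trace, hid, hrand]
  simp [mul_comm]

variable [DecidableEq a] [DecidableEq b]

lemma IsOneWayLOCC.covariantMap_overlapOperator (hd : 2 ≤ d)
    {𝓛 : Superop (Fin d × (a × b)) (Fin d)} (h𝓛 : IsOneWayLOCC 𝓛) :
    IsOneWayLOCC (Teleport.covariantMap d (overlapOperator 𝓛) (1 - overlapOperator 𝓛)) := by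
  refine h𝓛.covariantMap hd (add_sub_cancel _ _) fun τ => ?_
  have hd' : (d : ℂ) ≠ 0 := by
    have : d ≠ 0 := by omega
    exact_mod_cast this
  rw [trace_overlapOperator_mul]
  field_simp

/-- On a state, the covariant map of `K` and `L` mixes the identity, with probability `Tr[K ρ]`, and
the randomizing channel. -/
lemma simChannel_covariantMap_eq_mix {K L : Matrix (a × b) (a × b) ℂ} (hK : K.PosSemidef)
    (hL : L.PosSemidef) (hKL : K + L = 1) {ρ : Matrix (a × b) (a × b) ℂ} (hρ : IsState ρ) :
    0 ≤ (K * ρ).trace.re ∧ (K * ρ).trace.re ≤ 1 ∧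
      simChannel (covariantMap d K L) ρ =
        (((K * ρ).trace.re : ℝ) : ℂ) • (LinearMap.id : Superop (Fin d) (Fin d)) +
        ((1 - (K * ρ).trace.re : ℝ) : ℂ) • randomizing d := by
  have h₁ := Complex.le_def.mp (trace_mul_nonneg hK hρ.1)
  have h₂ := Complex.le_def.mp (trace_mul_nonneg hL hρ.1)
  have hL' : (L * ρ).trace = 1 - (K * ρ).trace := by
    rw [eq_sub_iff_add_eq', ← Matrix.trace_add, ← Matrix.add_mul, hKL, Matrix.one_mul, hρ.2]
  have hre : (((K * ρ).trace.re : ℝ) : ℂ) = (K * ρ).trace :=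
    Complex.ext (by simp) (by simpa using h₁.2)
  refine ⟨h₁.1, ?_, ?_⟩
  · rw [hL'] at h₂
    simpa using h₂.1
  · rw [simChannel_covariantMap, hL', Complex.ofReal_sub, hre, Complex.ofReal_one]

/-- If the elements of `E` and of `1 - S` dominate each other from below, then
`inf E = 1 - sup S`. -/
lemma sInf_eq_one_sub_sSup {E S : Set ℝ} (hS : S.Nonempty) (hbdd : BddAbove S)
    (h₁ : ∀ e ∈ E, ∃ p ∈ S, 1 - p ≤ e) (h₂ : ∀ p ∈ S, ∃ e ∈ E, e ≤ 1 - p) :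
    sInf E = 1 - sSup S := by
  have hlow : ∀ e ∈ E, 1 - sSup S ≤ e := fun e he => by
    obtain ⟨p, hp, hpe⟩ := h₁ e he
    linarith [le_csSup hbdd hp]
  have hE : E.Nonempty := by
    obtain ⟨p, hp⟩ := hS
    obtain ⟨e, he, -⟩ := h₂ p hp
    exact ⟨e, he⟩
  refine le_antisymm ?_ (le_csInf hE hlow)
  have : sSup S ≤ 1 - sInf E := csSup_le hS fun p hp => by
    obtain ⟨e, he, hep⟩ := h₂ p hp
    linarith [csInf_le ⟨_, hlow⟩ he]
  linarith

/-- The values `Tr[K ρ]` over the operators `K` whose covariant map is one-way LOCC. -/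
def successValues (d : ℕ) (ρ : Matrix (a × b) (a × b) ℂ) : Set ℝ :=
  {t : ℝ | ∃ K L : Matrix (a × b) (a × b) ℂ, K.PosSemidef ∧ L.PosSemidef ∧ K + L = 1 ∧
    IsOneWayLOCC (covariantMap d K L) ∧ t = (K * ρ).trace.re}

/-- The entanglement fidelity of every one-way LOCC protocol is attained by a covariant one. -/
lemma entTrace_mem_successValues (hd : 2 ≤ d) {𝓛 : Superop (Fin d × (a × b)) (Fin d)}
    (h𝓛 : IsOneWayLOCC 𝓛) (ρ : Matrix (a × b) (a × b) ℂ) :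
    (entTrace (simChannel 𝓛 ρ) / (d : ℂ) ^ 2).re ∈ successValues d ρ :=
  ⟨overlapOperator 𝓛, 1 - overlapOperator 𝓛, overlapOperator_posSemidef h𝓛.isChannel.1,
    one_sub_overlapOperator_posSemidef (by omega) h𝓛.isChannel, add_sub_cancel _ _,
    h𝓛.covariantMap_overlapOperator hd, by rw [trace_overlapOperator_mul]⟩

lemma successValues_nonempty (hd : 2 ≤ d) (ρ : Matrix (a × b) (a × b) ℂ) :
    (successValues d ρ).Nonempty := by
  obtain ⟨𝓛, h𝓛⟩ := exists_isOneWayLOCC (d := d) (a := a) (b := b) (by omega)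
  exact ⟨_, entTrace_mem_successValues hd h𝓛 ρ⟩

lemma bddAbove_successValues {ρ : Matrix (a × b) (a × b) ℂ} (hρ : IsState ρ) :
    BddAbove (successValues d ρ) := by
  refine ⟨1, ?_⟩
  rintro _ ⟨K, L, hK, hL, hKL, -, rfl⟩
  exact (simChannel_covariantMap_eq_mix (d := d) hK hL hKL hρ).2.1

lemma simError_eq (hd : 2 ≤ d) {ρ : Matrix (a × b) (a × b) ℂ} (hρ : IsState ρ) :
    simError d ρ = 1 - sSup (successValues d ρ) := by
  refine sInf_eq_one_sub_sSup (successValues_nonempty hd ρ) (bddAbove_successValues hρ) ?_ ?_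
  · rintro _ ⟨𝓛, h𝓛, rfl⟩
    exact ⟨_, entTrace_mem_successValues hd h𝓛 ρ,
      one_sub_entTrace_le_diamondDist (by omega) (h𝓛.isChannel.simChannel hρ)⟩
  · rintro _ ⟨K, L, hK, hL, hKL, h, rfl⟩
    obtain ⟨-, hp, hmix⟩ := simChannel_covariantMap_eq_mix (d := d) hK hL hKL hρ
    refine ⟨_, ⟨_, h, rfl⟩, ?_⟩
    rw [hmix]
    exact diamondDist_mix_le (isChannel_randomizing hd) hp

lemma simErrorF_eq (hd : 2 ≤ d) {ρ : Matrix (a × b) (a × b) ℂ} (hρ : IsState ρ) :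
    simErrorF d ρ = 1 - sSup (successValues d ρ) := by
  refine sInf_eq_one_sub_sSup (successValues_nonempty hd ρ) (bddAbove_successValues hρ) ?_ ?_
  · rintro _ ⟨𝓛, h𝓛, rfl⟩
    exact ⟨_, entTrace_mem_successValues hd h𝓛 ρ,
      sub_le_sub_left (channelFidelity_le_entTrace (by omega) (h𝓛.isChannel.simChannel hρ)) 1⟩
  · rintro _ ⟨K, L, hK, hL, hKL, h, rfl⟩
    obtain ⟨hp0, hp, hmix⟩ := simChannel_covariantMap_eq_mix (d := d) hK hL hKL hρ
    refine ⟨_, ⟨_, h, rfl⟩, ?_⟩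
    rw [hmix]
    exact sub_le_sub_left (le_channelFidelity_mix (by omega) (isChannel_randomizing hd) hp0 hp) 1

/-- The covariant map of `K` is one-way LOCC exactly if `K` is a sum of link products: such sums are
the operators representing the entanglement functional of one-way LOCC maps. Both directions pass
through `transposeConj`, since the Choi operator of `D` pairs with `τ` through `X ↦ D(Xᵀ)`. -/
lemma isOneWayLOCC_covariantMap_iff (hd : 2 ≤ d) {K L : Matrix (a × b) (a × b) ℂ}
    (hKL : K + L = 1) :
    IsOneWayLOCC (covariantMap d K L) ↔
      ∃ (r : ℕ) (Λ : Fin r → Matrix (Fin d × a) (Fin d × a) ℂ) (𝒟 : Fin r → Superop b (Fin d)),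
        IsPOVM Λ ∧ (∀ x, IsChannel (𝒟 x)) ∧
        K = (1 / (d : ℂ) ^ 2) • ∑ x, linkProduct (Λ x) (choi (𝒟 x)) := by
  have hd' : (d : ℂ) ≠ 0 := by
    have : d ≠ 0 := by omega
    exact_mod_cast this
  constructor
  · intro h
    obtain ⟨r, Λ, 𝒟, hΛ, h𝒟, he⟩ := h.exists_eq
    refine ⟨r, Λ, fun x => transposeConj (𝒟 x), hΛ, fun x => (h𝒟 x).transposeConj,
      Matrix.ext_iff_trace_mul_right.mpr fun τ => ?_⟩
    have h₁ := entTrace_simChannel_covariantMap hd K L τ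
    have h₂ := entTrace_oneWayMap Λ (fun x => transposeConj (𝒟 x)) τ
    simp only [transposeConj_transposeConj] at h₂
    rw [he, h₂] at h₁
    rw [Matrix.smul_mul, Matrix.trace_smul, h₁, smul_eq_mul]
    field_simp
  · rintro ⟨r, Λ, 𝒟, hΛ, h𝒟, rfl⟩
    refine (isOneWayLOCC_oneWayMap hΛ fun x => (h𝒟 x).transposeConj).covariantMap hd hKL fun τ => ?_
    rw [entTrace_oneWayMap, Matrix.smul_mul, Matrix.trace_smul, smul_eq_mul]
    field_simp

end Errors

end Teleport

end

theorem proposition1 {a b : Type*} [Fintype a] [DecidableEq a] [Fintype b] [DecidableEq b]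
    (d : ℕ) (hd : 2 ≤ d) :
    (∀ ρ : Matrix (a × b) (a × b) ℂ, Teleport.IsState ρ →
      Teleport.simError d ρ = Teleport.simErrorF d ρ ∧
      Teleport.simErrorF d ρ = 1 - sSup {t : ℝ | ∃ K L : Matrix (a × b) (a × b) ℂ,
        K.PosSemidef ∧ L.PosSemidef ∧ K + L = 1 ∧
        Teleport.IsOneWayLOCC (Teleport.covariantMap d K L) ∧ t = (K * ρ).trace.re}) ∧
    (∀ K L : Matrix (a × b) (a × b) ℂ, K.PosSemidef → L.PosSemidef → K + L = 1 →
      (Teleport.IsOneWayLOCC (Teleport.covariantMap d K L) ↔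
        ∃ (r : ℕ) (Λ : Fin r → Matrix (Fin d × a) (Fin d × a) ℂ)
          (𝒟 : Fin r → Teleport.Superop b (Fin d)),
          Teleport.IsPOVM Λ ∧ (∀ x, Teleport.IsChannel (𝒟 x)) ∧
          K = (1 / (d : ℂ) ^ 2) • ∑ x, Teleport.linkProduct (Λ x) (Teleport.choi (𝒟 x)))) := by
  exact ⟨fun ρ hρ => ⟨(Teleport.simError_eq hd hρ).trans (Teleport.simErrorF_eq hd hρ).symm,
    Teleport.simErrorF_eq hd hρ⟩,
    fun K L _ _ hKL => Teleport.isOneWayLOCC_covariantMap_iff hd hKL⟩
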